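/- Let $\Omega\subset\mathbb R^d$ be a bounded, convex, open set with $|\Omega|=2$, let $\sigma,\varepsilon,\tau,b_1,b_2>0$, and let $\Phi_1,\Phi_2:\Omega\to\mathbb R$ be Lipschitz. Put $$G_\varepsilon(x)=\frac{1}{(4\pi\varepsilon)^{d/2}}e^{-|x|^2/(4\varepsilon)},\qquad K_\varepsilon=\sigma\sqrt{\tfrac{2\pi}{\varepsilon}}\,G_\varepsilon ,$$ and, for functions $\rho$ on $\Omega$, $(K_\varepsilon\star\rho)(x)=\int_\Omega K_\varepsilon(x-y)\rho(y)\,dy$ and $(\nabla K_\varepsilon\star\rho)(x)=\int_\Omega \nabla K_\varepsilon(x-y)\rho(y)\,dy$. Call a pair $(\rho_1,\rho_2)$ of probability densities on $\Omega$ admissible if $\rho_1+\rho_2=1$ a.e. in $\Omega$; densities are identified with the corresponding measures. Let $\rho_1^n,\rho_2^n$ be Borel probability measures on $\mathbb R^d$ carried by $\overline\Omega$, and let $(\rho_1^*,\rho_2^*)$ be a minimizer, among admissible pairs, of $$\int_\Omega (K_\varepsilon\star\rho_1)\,\rho_2\,dx+\int_\Omega\Phi_1\rho_1\,dx+\int_\Omega\Phi_2\rho_2\,dx+\frac{b_1}{2\tau}W_2^2(\rho_1,\rho_1^n)+\frac{b_2}{2\tau}W_2^2(\rho_2,\rho_2^n),$$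 where $W_2^2(\mu,\nu)=\inf_\pi\int|x-y|^2\,d\pi$ over the transport plans $\pi$ between $\mu$ and $\nu$. A Kantorovich potential for the transport of $\mu$ onto $\nu$ is a $c$-concave function $\varphi$ on $\overline\Omega$, $c(x,y)=\frac12|x-y|^2$, such that $(\varphi,\varphi^c)$, with $\varphi^c(y)=\inf_{x\in\overline\Omega}(c(x,y)-\varphi(x))$, maximizes $\int f\,d\mu+\int g\,d\nu$ among continuous $f,g$ on $\overline\Omega$ with $f(x)+g(y)\le c(x,y)$ on $\overline\Omega\times\overline\Omega$. Then there are Kantorovich potentials $\varphi_1,\varphi_2$ for the transport of $\rho_1^*$ onto $\rho_1^n$ and of $\rho_2^*$ onto $\rho_2^n$, respectively, such that: (i) for every admissible pair $(\rho_1,\rho_2)$, $$\int_{\Omega}\Big[K_\varepsilon\star\rho_2^*+\Phi_1+\frac{b_1\varphi_1}{\tau}\Big](\rho_1-\rho_1^*)\,dx+\int_{\Omega}\Big[K_\varepsilon\star\rho_1^*+\Phi_2+\frac{b_2\varphi_2}{\tau}\Big](\rho_2-\rho_2^*)\,dx\ \ge 0;$$ (ii) there is a function $p$ that is Lipschitz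 continuous on $\operatorname{spt}(\rho_1^*)$ and on $\operatorname{spt}(\rho_2^*)$ (the closed supports) such that for every admissible pair $(\rho_1,\rho_2)$, $$\int_{\Omega}\Big[K_\varepsilon\star\rho_2^*+\Phi_1+\frac{b_1\varphi_1}{\tau}+p\Big](\rho_1-\rho_1^*)\,dx+\int_{\Omega}\Big[K_\varepsilon\star\rho_1^*+\Phi_2+\frac{b_2\varphi_2}{\tau}+p\Big](\rho_2-\rho_2^*)\,dx\ \ge 0,$$ and, with $p,\Phi_i,\varphi_i$ differentiable at a.e. point of $\Omega\cap\operatorname{spt}(\rho_i^*)$, $$\nabla p=-\nabla K_\varepsilon\star\rho_2^*-\nabla\Phi_1-\frac{b_1}{\tau}\nabla\varphi_1\ \text{ a.e. in }\Omega\cap\operatorname{spt}(\rho_1^*),\qquad \nabla p=-\nabla K_\varepsilon\star\rho_1^*-\nabla\Phi_2-\frac{b_2}{\tau}\nabla\varphi_2\ \text{ a.e. in }\Omega\cap\operatorname{spt}(\rho_2^*).$$ -/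

import Mathlib

open MeasureTheory

noncomputable section

namespace Muskat

/-- The space `ℝ^d` with the Euclidean norm. -/
abbrev Space (d : ℕ) : Type := EuclideanSpace ℝ (Fin d)

variable {d : ℕ}

/-! ### Probability densities on `Ω` -/

/-- The measure on `ℝ^d` with density `ρ` on `Ω` and density `0` outside `Ω`. -/
def densityMeasure (Ω : Set (Space d)) (ρ : Space d → ℝ) : Measure (Space d) :=
  (volume.restrict Ω).withDensity (fun x => ENNReal.ofReal (ρ x))

/-- `ρ` is a probability density on `Ω` with respect to Lebesgue measure
(only the values of `ρ` on `Ω` matter). -/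
structure IsProbDensity (Ω : Set (Space d)) (ρ : Space d → ℝ) : Prop where
  aemeasurable : AEMeasurable ρ (volume.restrict Ω)
  nonneg : ∀ᵐ x ∂volume.restrict Ω, 0 ≤ ρ x
  mass_one : ∫⁻ x in Ω, ENNReal.ofReal (ρ x) = 1

/-- Admissible pairs: two absolutely continuous probability measures on `Ω`
whose densities satisfy `ρ₁ + ρ₂ = 1` a.e. in `Ω`. -/
structure Admissible (Ω : Set (Space d)) (ρ₁ ρ₂ : Space d → ℝ) : Prop where
  left : IsProbDensity Ω ρ₁
  right : IsProbDensity Ω ρ₂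
  sum_eq_one : ∀ᵐ x ∂volume.restrict Ω, ρ₁ x + ρ₂ x = 1

/-- The support of the density `ρ` on `Ω`: the (closed) support in `ℝ^d` of the associated
measure. -/
def spt (Ω : Set (Space d)) (ρ : Space d → ℝ) : Set (Space d) :=
  (densityMeasure Ω ρ).support

/-! ### The heat content -/

/-- The heat kernel `G_ε(x) = (4πε)^{-d/2} exp(-|x|²/(4ε))`. -/
def heatKernel (ε : ℝ) (x : Space d) : ℝ :=
  1 / (4 * Real.pi * ε) ^ ((d : ℝ) / 2) * Real.exp (-‖x‖ ^ 2 / (4 * ε))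

/-- The kernel `K_ε = σ √(2π/ε) G_ε`. -/
def kernelK (σ ε : ℝ) (x : Space d) : ℝ :=
  σ * Real.sqrt (2 * Real.pi / ε) * heatKernel ε x

/-- The convolution `K_ε ⋆ ρ`, where `ρ` is extended by `0` outside `Ω`. -/
def convK (σ ε : ℝ) (Ω : Set (Space d)) (ρ : Space d → ℝ) (x : Space d) : ℝ :=
  ∫ y in Ω, kernelK σ ε (x - y) * ρ y

/-- The convolution `∇K_ε ⋆ ρ`, where `ρ` is extended by `0` outside `Ω`. -/
def convGradK (σ ε : ℝ) (Ω : Set (Space d)) (ρ : Space d → ℝ) (x : Space d) : Space d :=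
  ∫ y in Ω, ρ y • gradient (kernelK σ ε) (x - y)

/-- The heat content `HC_ε(ρ₁, ρ₂) = ∫_Ω (K_ε ⋆ ρ₁) ρ₂ dx`. -/
def heatContent (σ ε : ℝ) (Ω : Set (Space d)) (ρ₁ ρ₂ : Space d → ℝ) : ℝ :=
  ∫ x in Ω, convK σ ε Ω ρ₁ x * ρ₂ x

/-- The potential energy `∫_Ω Φ₁ ρ₁ dx + ∫_Ω Φ₂ ρ₂ dx`. -/
def potentialEnergy (Φ₁ Φ₂ : Space d → ℝ) (Ω : Set (Space d)) (ρ₁ ρ₂ : Space d → ℝ) : ℝ :=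
  (∫ x in Ω, Φ₁ x * ρ₁ x) + ∫ x in Ω, Φ₂ x * ρ₂ x

/-! ### Optimal transport -/

/-- The transport plans (couplings) between `μ` and `ν`. -/
def transportPlans (μ ν : Measure (Space d)) : Set (Measure (Space d × Space d)) :=
  {π | π.map Prod.fst = μ ∧ π.map Prod.snd = ν}

/-- The squared 2-Wasserstein distance
`W₂²(μ, ν) = inf { ∫ |x - y|² dπ(x, y) : π a transport plan between μ and ν }`. -/
def W2sq (μ ν : Measure (Space d)) : ℝ :=
  (⨅ π ∈ transportPlans μ ν, ∫⁻ z, ENNReal.ofReal (‖z.1 - z.2‖ ^ 2) ∂π).toReal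

/-- The quadratic cost `c(x, y) = |x - y|² / 2`. -/
def cost (x y : Space d) : ℝ := ‖x - y‖ ^ 2 / 2

/-- `φ` is `c`-concave on `X`: there is a function `ψ` on `X` such that
`φ(x) = inf_{y ∈ X} (c(x, y) - ψ(y))` for all `x ∈ X`. -/
def IsCConcaveOn (X : Set (Space d)) (φ : Space d → ℝ) : Prop :=
  ∃ ψ : Space d → ℝ, ∀ x ∈ X, IsGLB ((fun y => cost x y - ψ y) '' X) (φ x)

/-- The `c`-transform `φ^c(y) = inf_{x ∈ X} (c(x, y) - φ(x))`. -/
def cTransform (X : Set (Space d)) (φ : Space d → ℝ) (y : Space d) : ℝ :=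
  ⨅ x : X, (cost (x : Space d) y - φ x)

/-- `φ` is a Kantorovich potential on the compact set `X` for the transport of `μ` onto `ν`
(both carried by `X`) with cost `c`: `φ` is `c`-concave and `(φ, φ^c)` maximizes
`∫ f dμ + ∫ g dν` among the continuous pairs with `f(x) + g(y) ≤ c(x, y)` on `X × X`. -/
structure IsKantorovichPotential (X : Set (Space d)) (μ ν : Measure (Space d))
    (φ : Space d → ℝ) : Prop where
  cConcave : IsCConcaveOn X φ
  maximal : ∀ f g : Space d → ℝ, ContinuousOn f X → ContinuousOn g X →
    (∀ x ∈ X, ∀ y ∈ X, f x + g y ≤ cost x y) →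
    (∫ x in X, f x ∂μ) + (∫ y in X, g y ∂ν) ≤
      (∫ x in X, φ x ∂μ) + ∫ y in X, cTransform X φ y ∂ν

/-! ### The minimizing movements scheme -/

/-- The functional minimized in one step of the scheme started at `(μ₁, μ₂)`:
`HC_ε(ρ₁, ρ₂) + Φ(ρ₁, ρ₂) + b₁/(2τ) W₂²(ρ₁, μ₁) + b₂/(2τ) W₂²(ρ₂, μ₂)`. -/
def stepEnergy (σ ε τ b₁ b₂ : ℝ) (Φ₁ Φ₂ : Space d → ℝ) (Ω : Set (Space d))
    (μ₁ μ₂ : Measure (Space d)) (ρ₁ ρ₂ : Space d → ℝ) : ℝ :=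
  heatContent σ ε Ω ρ₁ ρ₂ + potentialEnergy Φ₁ Φ₂ Ω ρ₁ ρ₂
    + b₁ / (2 * τ) * W2sq (densityMeasure Ω ρ₁) μ₁
    + b₂ / (2 * τ) * W2sq (densityMeasure Ω ρ₂) μ₂

/-- `(ρ₁, ρ₂)` minimizes the one-step functional among all admissible pairs. -/
def IsStepMinimizer (σ ε τ b₁ b₂ : ℝ) (Φ₁ Φ₂ : Space d → ℝ) (Ω : Set (Space d))
    (μ₁ μ₂ : Measure (Space d)) (ρ₁ ρ₂ : Space d → ℝ) : Prop :=
  Admissible Ω ρ₁ ρ₂ ∧ ∀ η₁ η₂ : Space d → ℝ, Admissible Ω η₁ η₂ →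
    stepEnergy σ ε τ b₁ b₂ Φ₁ Φ₂ Ω μ₁ μ₂ ρ₁ ρ₂ ≤
      stepEnergy σ ε τ b₁ b₂ Φ₁ Φ₂ Ω μ₁ μ₂ η₁ η₂

end Muskat

end

/-! ### Kantorovich duality on compact spaces -/

namespace Muskat

set_option linter.unusedSectionVars false

/-! The heat content is bilinear and symmetric, and `W2sq` is convex under mixtures of measures.
Comparing the minimizer with `(1 - t)ρ + tη` and letting `t → 0` shows that it also minimizes the
functional in which the heat content is replaced by its linearization, with costs `A₁ = K_ε ⋆ ρ₂ +
Φ₁` and `A₂ = K_ε ⋆ ρ₁ + Φ₂` (`IsStepMinimizer.linearized_le`).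

The linearized problem is a single transport problem: Lebesgue measure on `Ω`, of mass 2, is sent
onto the disjoint union of the two targets, with cost `A_i(x) + κ_i c(x, y)` towards the target
labelled `i` and `κ_i = b_i / τ`. The constraint `ρ₁ + ρ₂ = 1` is its source marginal. Its dual has
potentials `u`, `v₁`, `v₂` with `u + v_i ≤ A_i + κ_i c`. Strong duality comes from Hahn–Banach and
Riesz–Markov (`exists_plan_integral_le`), dual attainment from Arzelà–Ascoli
(`exists_optimal_potentials`); both enter `exists_dual_potentials_pair`.

Optimality of `(ρ₁, ρ₂)` forces equality in weak duality for each component separately. The double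
`c`-transform `φ_i` of `(u - A_i) / κ_i` is then a Kantorovich potential, and the slack `A_i + κ_i
φ_i - u` is nonnegative on `closure Ω` and zero on the support of `ρ_i`
(`exists_potential_of_optimal`). With `p = -u` this gives the second variational inequality, and the
first follows because `∫ u (η₁ + η₂)` is the same for all admissible pairs. The gradient identities
are the first order conditions at the zeros of the slack, valid a.e. by Rademacher. -/

theorem exists_linearMap_eq_of_le_sublinear {E : Type*} [AddCommGroup E] [Module ℝ E] (N : E → ℝ)
    (N_hom : ∀ c : ℝ, 0 < c → ∀ x, N (c • x) = c * N x) (N_add : ∀ x y, N (x + y) ≤ N x + N y)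
    (x : E) : ∃ g : E →ₗ[ℝ] ℝ, g x = N x ∧ ∀ y, g y ≤ N y := by
  have N0 : N 0 = 0 := by grind [N_hom 2 (by norm_num) 0, smul_zero]
  -- On the line through `x` the functional `c • x ↦ c * N x` lies below `N`; negative `c` uses `0 =
  -- N 0 ≤ N (c • x) + N (-c • x)`. Hahn–Banach then extends it.
  have key : ∀ c : ℝ, c * N x ≤ N (c • x) := by
    intro c
    rcases lt_trichotomy c 0 with hc | hc | hc
    · have h1 := N_add (c • x) ((-c) • x)
      rw [← add_smul, add_neg_cancel, zero_smul, N0, N_hom (-c) (by linarith)] at h1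
      linarith
    · simp [hc, N0]
    · rw [N_hom c hc]
  have H : ∀ c : ℝ, c • x = 0 → (RingHom.id ℝ) c • N x = 0 := by
    intro c hc
    by_cases h : c = 0
    · simp [h]
    · have : x = 0 := by simpa [h] using hc
      simp [this, N0]
  obtain ⟨g, hg, hgN⟩ := exists_extension_of_le_sublinear
    (LinearPMap.mkSpanSingleton' (σ := RingHom.id ℝ) x (N x) H) N N_hom N_add (by
      rintro ⟨y, hy⟩
      obtain ⟨c, rfl⟩ := Submodule.mem_span_singleton.1 hy
      rw [LinearPMap.mkSpanSingleton'_apply]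
      exact key c)
  refine ⟨g, ?_, hgN⟩
  have hx : (1 : ℝ) • x ∈ (LinearPMap.mkSpanSingleton' (σ := RingHom.id ℝ) x (N x) H).domain :=
    Submodule.mem_span_singleton.2 ⟨1, rfl⟩
  have := hg ⟨_, hx⟩
  rw [LinearPMap.mkSpanSingleton'_apply] at this
  simpa using this

theorem exists_measure_of_nonneg_functional {Z : Type*} [TopologicalSpace Z] [CompactSpace Z]
    [T2Space Z] [MeasurableSpace Z] [BorelSpace Z] (l : C(Z, ℝ) →ₗ[ℝ] ℝ)
    (hl : ∀ h, 0 ≤ h → 0 ≤ l h) :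
    ∃ π : Measure Z, IsFiniteMeasure π ∧ ∀ h : C(Z, ℝ), ∫ z, h z ∂π = l h := by
  let l' : CompactlySupportedContinuousMap Z ℝ →ₗ[ℝ] ℝ :=
    { toFun := fun f => l f.toContinuousMap
      map_add' := fun f g => l.map_add f.toContinuousMap g.toContinuousMap
      map_smul' := fun c f => l.map_smul c f.toContinuousMap }
  let Λ := PositiveLinearMap.mk₀ l' (fun f hf => hl f.toContinuousMap hf)
  refine ⟨RealRMK.rieszMeasure Λ, inferInstance, fun h => ?_⟩
  exact RealRMK.integral_rieszMeasure Λ (CompactlySupportedContinuousMap.continuousMapEquiv h)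

/-! ### Transforms of continuous functions and compactness of Lipschitz families -/

section Transform

variable {X Y : Type*} [TopologicalSpace X] [CompactSpace X] [Nonempty X] [TopologicalSpace Y]

/-- The infimum of a continuous function on a compact space is `1`-Lipschitz. -/
theorem lipschitzWith_iInf : LipschitzWith 1 (fun f : C(X, ℝ) => ⨅ x, f x) := by
  refine LipschitzWith.of_le_add fun f g => ?_
  rw [← sub_le_iff_le_add]
  refine le_ciInf fun x => ?_
  have h1 : ⨅ x, f x ≤ f x := ciInf_le (isCompact_range f.continuous).bddBelow x
  have h2 := (abs_le.1 (ContinuousMap.dist_apply_le_dist (f := f) (g := g) x)).2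
  linarith

/-- The `C`-transform of a continuous function for a continuous cost `C`. -/
noncomputable def continuousTransform (C : C(X × Y, ℝ)) (u : C(X, ℝ)) : C(Y, ℝ) where
  toFun y := ⨅ x, ((C.comp ContinuousMap.prodSwap).curry y - u) x
  -- Currying makes `y ↦ C(·, y)` continuous into `C(X, ℝ)` with the uniform norm.
  continuous_toFun := lipschitzWith_iInf.continuous.comp
    ((C.comp ContinuousMap.prodSwap).curry.continuous.sub continuous_const)

theorem continuousTransform_add_le (C : C(X × Y, ℝ)) (u : C(X, ℝ)) (x : X) (y : Y) :
    u x + continuousTransform C u y ≤ C (x, y) := by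
  have h := ciInf_le (isCompact_range
    ((C.comp ContinuousMap.prodSwap).curry y - u).continuous).bddBelow x
  have h' : continuousTransform C u y ≤ C (x, y) - u x := h
  linarith

theorem le_continuousTransform {C : C(X × Y, ℝ)} {u : C(X, ℝ)} {y : Y} {r : ℝ}
    (h : ∀ x, u x + r ≤ C (x, y)) : r ≤ continuousTransform C u y :=
  le_ciInf fun x => by
    change r ≤ C (x, y) - u x
    linarith [h x]

end Transform

/-- Pinning the value at `x₀` turns the Lipschitz bound into a pointwise bound, so Arzelà–Ascoli
applies. The dual maximizer is sought in this set. -/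
theorem isCompact_lipschitz_pointed {X : Type*} [MetricSpace X] (K : NNReal) (x₀ : X) :
    IsCompact {u : C(X, ℝ) | u x₀ = 0 ∧ LipschitzWith K u} := by
  refine ArzelaAscoli.isCompact_of_equicontinuous _ ?_ ?_
  · have : ContinuousMap.toFun '' {u : C(X, ℝ) | u x₀ = 0 ∧ LipschitzWith K u} =
        {f : X → ℝ | f x₀ = 0 ∧ LipschitzWith K f} := by
      ext f
      constructor
      · rintro ⟨u, hu, rfl⟩
        exact hu
      · intro hf
        exact ⟨⟨f, hf.2.continuous⟩, hf, rfl⟩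
    rw [this]
    refine IsCompact.of_isClosed_subset
      (isCompact_univ_pi fun x : X => isCompact_Icc (a := -(K * dist x x₀)) (b := K * dist x x₀))
      ?_ ?_
    · refine IsClosed.inter (isClosed_eq (continuous_apply x₀) continuous_const) ?_
      have : {f : X → ℝ | LipschitzWith K f} =
          ⋂ x, ⋂ y, {f : X → ℝ | dist (f x) (f y) ≤ K * dist x y} := by
        ext f
        simp [lipschitzWith_iff_dist_le_mul]
      change IsClosed {f : X → ℝ | LipschitzWith K f}
      rw [this]
      refine isClosed_iInter fun x => isClosed_iInter fun y => ?_
      exact isClosed_le ((continuous_apply x).dist (continuous_apply y)) continuous_const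
    · rintro f ⟨h0, hf⟩ x -
      have := hf.dist_le_mul x x₀
      rw [h0, Real.dist_eq, sub_zero] at this
      exact abs_le.1 this
  · exact (LipschitzWith.uniformEquicontinuous _ K fun u => u.2.2).equicontinuous

/-! ### Strong duality and dual attainment -/

section Duality

variable {X Y : Type*} [MetricSpace X] [CompactSpace X] [Nonempty X] [MeasurableSpace X]
  [BorelSpace X] [TopologicalSpace Y] [CompactSpace Y] [T2Space Y] [Nonempty Y]
  [MeasurableSpace Y] [BorelSpace Y]

theorem _root_.ContinuousMap.integrable_of_compactSpace {Z : Type*} [TopologicalSpace Z]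
    [CompactSpace Z] [MeasurableSpace Z] [BorelSpace Z] (f : C(Z, ℝ)) (μ : Measure Z)
    [IsFiniteMeasure μ] : Integrable f μ :=
  f.continuous.integrable_of_hasCompactSupport (HasCompactSupport.of_compactSpace f)

/-- The values of the dual problem for the lower bound `h`. -/
def dualValues (μ : Measure X) (ν : Measure Y) (h : C(X × Y, ℝ)) : Set ℝ :=
  {s | ∃ (u : C(X, ℝ)) (v : C(Y, ℝ)), (∀ x y, h (x, y) ≤ u x + v y) ∧
    s = ∫ x, u x ∂μ + ∫ y, v y ∂ν}

variable (μ : Measure X) [IsFiniteMeasure μ] (ν : Measure Y) [IsFiniteMeasure ν]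

/-- At a minimum point `x₀` of `u` the constraint gives `v ≥ -‖h‖ - u x₀`; the two occurrences of `u
x₀` cancel after integration because the masses agree. -/
theorem le_of_mem_dualValues (hm : μ.real Set.univ = ν.real Set.univ) {h : C(X × Y, ℝ)} {s : ℝ}
    (hs : s ∈ dualValues μ ν h) : -‖h‖ * μ.real Set.univ ≤ s := by
  obtain ⟨u, v, huv, rfl⟩ := hs
  obtain ⟨x₀, hx₀⟩ := u.continuous.exists_forall_le_of_hasCompactSupport
    (HasCompactSupport.of_compactSpace u)
  have h1 : ∫ _x : X, u x₀ ∂μ ≤ ∫ x, u x ∂μ :=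
    integral_mono (integrable_const _) (u.integrable_of_compactSpace μ) hx₀
  have h2 : ∫ _y : Y, (-‖h‖ - u x₀) ∂ν ≤ ∫ y, v y ∂ν := by
    refine integral_mono (integrable_const _) (v.integrable_of_compactSpace ν) fun y => ?_
    have := (abs_le.1 (h.norm_coe_le_norm (x₀, y))).1
    have := huv x₀ y
    linarith
  simp only [integral_const, smul_eq_mul] at h1 h2
  rw [← hm] at h2
  linarith

theorem dualValues_nonempty (h : C(X × Y, ℝ)) : (dualValues μ ν h).Nonempty :=
  ⟨_, ContinuousMap.const X ‖h‖, 0, fun x y => by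
    simpa using (abs_le.1 (h.norm_coe_le_norm (x, y))).2, rfl⟩

/-- There is a transport plan whose cost is at most the supremum of the dual problem. -/
theorem exists_plan_integral_le [TopologicalSpace.MetrizableSpace Y]
    (hm : μ.real Set.univ = ν.real Set.univ) (C : C(X × Y, ℝ)) :
    ∃ π : Measure (X × Y), IsFiniteMeasure π ∧ π.map Prod.fst = μ ∧ π.map Prod.snd = ν ∧
      ∀ r : ℝ, (∀ (u : C(X, ℝ)) (v : C(Y, ℝ)), (∀ x y, u x + v y ≤ C (x, y)) →
        ∫ x, u x ∂μ + ∫ y, v y ∂ν ≤ r) → ∫ z, C z ∂π ≤ r := by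
  have bdd : ∀ h, BddBelow (dualValues μ ν h) := fun h =>
    ⟨_, fun s hs => le_of_mem_dualValues μ ν hm hs⟩
  have hint : ∀ u : C(X, ℝ), Integrable u μ := fun u => u.integrable_of_compactSpace μ
  have hint' : ∀ v : C(Y, ℝ), Integrable v ν := fun v => v.integrable_of_compactSpace ν
  -- The least dual cost of dominating `h` is sublinear. A linear `l ≤ N` is automatically
  -- integration against a plan, and contact at `-C` makes `l C = -N (-C)` the dual supremum.
  let N : C(X × Y, ℝ) → ℝ := fun h => sInf (dualValues μ ν h)
  have N_le : ∀ (h : C(X × Y, ℝ)) (u : C(X, ℝ)) (v : C(Y, ℝ)),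
      (∀ x y, h (x, y) ≤ u x + v y) → N h ≤ ∫ x, u x ∂μ + ∫ y, v y ∂ν :=
    fun h u v huv => csInf_le (bdd h) ⟨u, v, huv, rfl⟩
  have le_N : ∀ (h : C(X × Y, ℝ)) (r : ℝ), (∀ (u : C(X, ℝ)) (v : C(Y, ℝ)),
      (∀ x y, h (x, y) ≤ u x + v y) → r ≤ ∫ x, u x ∂μ + ∫ y, v y ∂ν) → r ≤ N h := by
    intro h r H
    refine le_csInf (dualValues_nonempty μ ν h) ?_
    rintro s ⟨u, v, huv, rfl⟩
    exact H u v huv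
  have N_smul_le : ∀ c : ℝ, 0 < c → ∀ h, c * N h ≤ N (c • h) := by
    intro c hc h
    refine le_N _ _ fun u v huv => ?_
    have := N_le h (c⁻¹ • u) (c⁻¹ • v) (fun x y => by
      have h1 := huv x y
      simp only [ContinuousMap.coe_smul, Pi.smul_apply, smul_eq_mul] at h1 ⊢
      rw [← mul_add, le_inv_mul_iff₀ hc]
      exact h1)
    simp only [ContinuousMap.coe_smul, Pi.smul_apply, smul_eq_mul, integral_const_mul] at this
    rwa [← mul_add, le_inv_mul_iff₀ hc] at this
  have N_hom : ∀ c : ℝ, 0 < c → ∀ h, N (c • h) = c * N h := by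
    intro c hc h
    refine le_antisymm ?_ (N_smul_le c hc h)
    have := N_smul_le c⁻¹ (inv_pos.2 hc) (c • h)
    rwa [smul_smul, inv_mul_cancel₀ hc.ne', one_smul, inv_mul_le_iff₀ hc] at this
  have N_add : ∀ h k, N (h + k) ≤ N h + N k := by
    intro h k
    rw [← sub_le_iff_le_add]
    refine le_N _ _ fun u v huv => ?_
    rw [sub_le_iff_le_add, ← sub_le_iff_le_add']
    refine le_N _ _ fun u' v' huv' => ?_
    rw [sub_le_iff_le_add']
    refine (N_le (h + k) (u + u') (v + v') fun x y => ?_).trans (le_of_eq ?_)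
    · have := huv x y
      have := huv' x y
      simp only [ContinuousMap.add_apply]
      linarith
    · simp only [ContinuousMap.add_apply]
      rw [integral_add (hint u) (hint u'), integral_add (hint' v) (hint' v')]
      ring
  obtain ⟨l, hlC, hlN⟩ := exists_linearMap_eq_of_le_sublinear N N_hom N_add (-C)
  obtain ⟨π, hπ, hπl⟩ := exists_measure_of_nonneg_functional l (by
    intro h hh
    have h1 := (hlN (-h)).trans (N_le (-h) 0 0 fun x y => by simpa using hh (x, y))
    simp only [map_neg, ContinuousMap.zero_apply, integral_zero] at h1
    linarith)
  refine ⟨π, hπ, ?_, ?_, ?_⟩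
  · refine ext_of_forall_integral_eq_of_IsFiniteMeasure fun f => ?_
    rw [integral_map measurable_fst.aemeasurable
      f.continuous.measurable.aestronglyMeasurable]
    -- The pair `(u, 0)` dominates `u ∘ fst`; using this for both `f` and `-f` yields equality,
    -- hence the first marginal.
    have key : ∀ u : C(X, ℝ), l (u.comp ContinuousMap.fst) ≤ ∫ x, u x ∂μ := fun u => by
      simpa using (hlN (u.comp ContinuousMap.fst)).trans
        (N_le (u.comp ContinuousMap.fst) u 0 fun x y => by simp)
    have h1 := key f.toContinuousMap
    have h2 := key (-f.toContinuousMap)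
    rw [ContinuousMap.neg_comp, map_neg] at h2
    simp only [ContinuousMap.neg_apply, integral_neg] at h2
    refine (hπl (f.toContinuousMap.comp ContinuousMap.fst)).trans (le_antisymm h1 ?_)
    exact neg_le_neg_iff.1 h2
  · refine ext_of_forall_integral_eq_of_IsFiniteMeasure fun f => ?_
    rw [integral_map measurable_snd.aemeasurable
      f.continuous.measurable.aestronglyMeasurable]
    have key : ∀ v : C(Y, ℝ), l (v.comp ContinuousMap.snd) ≤ ∫ y, v y ∂ν := fun v => by
      simpa using (hlN (v.comp ContinuousMap.snd)).trans
        (N_le (v.comp ContinuousMap.snd) 0 v fun x y => by simp)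
    have h1 := key f.toContinuousMap
    have h2 := key (-f.toContinuousMap)
    rw [ContinuousMap.neg_comp, map_neg] at h2
    simp only [ContinuousMap.neg_apply, integral_neg] at h2
    refine (hπl (f.toContinuousMap.comp ContinuousMap.snd)).trans (le_antisymm h1 ?_)
    exact neg_le_neg_iff.1 h2
  · intro r hr
    have h1 : -r ≤ N (-C) := by
      refine le_N _ _ fun u v huv => ?_
      have := hr (-u) (-v) (fun x y => by
        have := huv x y
        simp only [ContinuousMap.neg_apply] at this ⊢
        linarith)
      simp only [ContinuousMap.neg_apply, integral_neg] at this
      linarith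
    rw [hπl, ← neg_neg C, map_neg, hlC]
    linarith

/-- Existence of optimal dual potentials for a cost that is Lipschitz in the first variable. -/
theorem exists_optimal_potentials (hm : μ.real Set.univ = ν.real Set.univ) (C : C(X × Y, ℝ))
    (K : NNReal) (hC : ∀ x x' y, C (x, y) ≤ C (x', y) + K * dist x x') :
    ∃ (u : C(X, ℝ)) (v : C(Y, ℝ)), LipschitzWith K u ∧ (∀ x y, u x + v y ≤ C (x, y)) ∧
      ∀ (u' : C(X, ℝ)) (v' : C(Y, ℝ)), (∀ x y, u' x + v' y ≤ C (x, y)) →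
        ∫ x, u' x ∂μ + ∫ y, v' y ∂ν ≤ ∫ x, u x ∂μ + ∫ y, v y ∂ν := by
  have hint : ∀ u : C(X, ℝ), Integrable u μ := fun u => u.integrable_of_compactSpace μ
  have hint' : ∀ v : C(Y, ℝ), Integrable v ν := fun v => v.integrable_of_compactSpace ν
  let x₀ : X := Classical.arbitrary X
  -- For fixed `u` the best partner is its transform, so the dual problem reduces to maximizing a
  -- function of `u` alone.
  let D : C(X, ℝ) → ℝ := fun u => ∫ x, u x ∂μ + ∫ y, continuousTransform C u y ∂ν
  have hD : LipschitzWith (μ.real Set.univ + ν.real Set.univ).toNNReal D := by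
    refine LipschitzWith.of_le_add_mul _ fun u w => ?_
    rw [Real.coe_toNNReal _ (by positivity)]
    have h1 : ∫ x, u x ∂μ ≤ ∫ x, (w x + dist u w) ∂μ :=
      integral_mono (hint u) ((hint w).add (integrable_const _)) fun x => by
        have := (abs_le.1 (ContinuousMap.dist_apply_le_dist (f := u) (g := w) x)).2
        change u x ≤ w x + dist u w
        linarith
    have h2 : ∫ y, continuousTransform C u y ∂ν
        ≤ ∫ y, (continuousTransform C w y + dist u w) ∂ν :=
      integral_mono (hint' _) ((hint' _).add (integrable_const _)) fun y => by
        change continuousTransform C u y ≤ continuousTransform C w y + dist u w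
        rw [← sub_le_iff_le_add]
        refine le_continuousTransform fun x => ?_
        have := (abs_le.1 (ContinuousMap.dist_apply_le_dist (f := u) (g := w) x)).1
        have := continuousTransform_add_le C u x y
        linarith
    rw [integral_add (hint w) (integrable_const _), integral_const, smul_eq_mul] at h1
    rw [integral_add (hint' _) (integrable_const _), integral_const, smul_eq_mul] at h2
    change _ + _ ≤ _ + _ + _
    linarith
  obtain ⟨u, hu, hmax⟩ := (isCompact_lipschitz_pointed K x₀).exists_isMaxOn
    ⟨0, rfl, LipschitzWith.const' 0⟩ hD.continuous.continuousOn
  refine ⟨u, continuousTransform C u, hu.2, continuousTransform_add_le C u, ?_⟩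
  intro u' v' huv'
  let C' : C(Y × X, ℝ) := C.comp ContinuousMap.prodSwap
  -- Any competitor improves when `u'` is replaced by the transform of `v'`, which inherits the
  -- constant `K` from the cost. Subtracting `w x₀` lands in the compact set and leaves the value
  -- unchanged, as the masses are equal.
  let w : C(X, ℝ) := continuousTransform C' v'
  have hwC : ∀ x y, w x + v' y ≤ C (x, y) := fun x y => by
    rw [add_comm]
    exact continuousTransform_add_le C' v' y x
  have hw : LipschitzWith K w := by
    refine LipschitzWith.of_le_add_mul _ fun x x' => ?_
    rw [← sub_le_iff_le_add]
    refine le_continuousTransform fun y => ?_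
    have h1 := hwC x y
    have h2 := hC x x' y
    change v' y + (w x - _) ≤ C (x', y)
    linarith
  let w₀ : C(X, ℝ) := w - ContinuousMap.const X (w x₀)
  have hw₀ : w₀ ∈ {u : C(X, ℝ) | u x₀ = 0 ∧ LipschitzWith K u} := by
    refine ⟨by simp [w₀], LipschitzWith.of_dist_le_mul fun x y => ?_⟩
    simpa [w₀] using hw.dist_le_mul x y
  refine le_trans ?_ (hmax hw₀)
  have h1 : ∫ x, u' x ∂μ ≤ ∫ x, (w₀ x + w x₀) ∂μ :=
    integral_mono (hint u') ((hint w₀).add (integrable_const _)) fun x => by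
      have : u' x ≤ w x := le_continuousTransform fun y => by
        rw [add_comm]
        exact huv' x y
      simpa [w₀] using this
  have h2 : ∫ y, v' y ∂ν ≤ ∫ y, (continuousTransform C w₀ y - w x₀) ∂ν :=
    integral_mono (hint' v') ((hint' _).sub (integrable_const _)) fun y => by
      change v' y ≤ continuousTransform C w₀ y - w x₀
      rw [le_sub_iff_add_le]
      refine le_continuousTransform fun x => ?_
      have := hwC x y
      simp only [w₀, ContinuousMap.sub_apply, ContinuousMap.const_apply]
      linarith
  rw [integral_add (hint w₀) (integrable_const _), integral_const, smul_eq_mul] at h1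
  rw [integral_sub (hint' _) (integrable_const _), integral_const, smul_eq_mul, ← hm] at h2
  change _ ≤ _ + _
  linarith

end Duality

end Muskat

namespace Muskat

variable {d : ℕ}

/-! ### The quadratic transport cost between measures carried by a compact set -/

theorem restrict_eq_of_measure_compl {α : Type*} [MeasurableSpace α] {μ : Measure α} {X : Set α}
    (h : μ Xᶜ = 0) : μ.restrict X = μ :=
  Measure.restrict_eq_self_of_ae_mem h

theorem ae_mem_of_mem_transportPlans {X : Set (Space d)} {μ ν : Measure (Space d)}
    (hμ : μ Xᶜ = 0) (hν : ν Xᶜ = 0) {π : Measure (Space d × Space d)}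
    (hπ : π ∈ transportPlans μ ν) : ∀ᵐ z ∂π, z.1 ∈ X ∧ z.2 ∈ X := by
  obtain ⟨h1, h2⟩ := hπ
  have h1' : ∀ᵐ x ∂(π.map Prod.fst), x ∈ X := by rw [h1]; exact hμ
  have h2' : ∀ᵐ x ∂(π.map Prod.snd), x ∈ X := by rw [h2]; exact hν
  exact (ae_of_ae_map measurable_fst.aemeasurable h1').and
    (ae_of_ae_map measurable_snd.aemeasurable h2')

theorem isProbabilityMeasure_of_mem_transportPlans {μ ν : Measure (Space d)}
    [IsProbabilityMeasure μ] {π : Measure (Space d × Space d)} (hπ : π ∈ transportPlans μ ν) :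
    IsProbabilityMeasure π := by
  refine ⟨?_⟩
  rw [← Set.preimage_univ (f := Prod.fst), ← Measure.map_apply measurable_fst MeasurableSet.univ,
    hπ.1, measure_univ]

theorem integrable_sq_of_mem_transportPlans {X : Set (Space d)} (hX : Bornology.IsBounded X)
    {μ ν : Measure (Space d)} [IsProbabilityMeasure μ] (hμ : μ Xᶜ = 0) (hν : ν Xᶜ = 0)
    {π : Measure (Space d × Space d)} (hπ : π ∈ transportPlans μ ν) :
    Integrable (fun z : Space d × Space d => ‖z.1 - z.2‖ ^ 2) π := by
  have := isProbabilityMeasure_of_mem_transportPlans hπ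
  refine Integrable.of_bound (C := Metric.diam X ^ 2)
    (by fun_prop : Continuous fun z : Space d × Space d => ‖z.1 - z.2‖ ^ 2).aestronglyMeasurable ?_
  filter_upwards [ae_mem_of_mem_transportPlans hμ hν hπ] with z hz
  rw [Real.norm_of_nonneg (by positivity), ← dist_eq_norm]
  exact pow_le_pow_left₀ dist_nonneg (Metric.dist_le_diam_of_mem hX hz.1 hz.2) 2

section Wasserstein

variable {X : Set (Space d)} (hX : Bornology.IsBounded X) {μ ν : Measure (Space d)}
  [IsProbabilityMeasure μ] [IsProbabilityMeasure ν] (hμ : μ Xᶜ = 0) (hν : ν Xᶜ = 0)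

include hX hμ hν

theorem lintegral_sq_of_mem_transportPlans
    {π : Measure (Space d × Space d)} (hπ : π ∈ transportPlans μ ν) :
    ∫⁻ z, ENNReal.ofReal (‖z.1 - z.2‖ ^ 2) ∂π = ENNReal.ofReal (∫ z, ‖z.1 - z.2‖ ^ 2 ∂π) :=
  (ofReal_integral_eq_lintegral_ofReal (integrable_sq_of_mem_transportPlans hX hμ hν hπ)
    (Filter.Eventually.of_forall fun z => by positivity)).symm

/-- The product measure is a competitor of finite cost. Finiteness is needed since `toReal` in
`W2sq` sends `⊤` to `0`, which would destroy lower bounds. -/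
theorem iInf_transportPlans_ne_top :
    ⨅ π ∈ transportPlans μ ν, ∫⁻ z, ENNReal.ofReal (‖z.1 - z.2‖ ^ 2) ∂π ≠ ⊤ := by
  have hπ : μ.prod ν ∈ transportPlans μ ν := by
    constructor
    · rw [Measure.map_fst_prod]; simp
    · rw [Measure.map_snd_prod]; simp
  refine ne_top_of_le_ne_top ?_ (iInf₂_le _ hπ)
  rw [lintegral_sq_of_mem_transportPlans hX hμ hν hπ]
  exact ENNReal.ofReal_ne_top

theorem W2sq_le_integral {π : Measure (Space d × Space d)} (hπ : π ∈ transportPlans μ ν) :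
    W2sq μ ν ≤ ∫ z, ‖z.1 - z.2‖ ^ 2 ∂π := by
  refine ENNReal.toReal_le_of_le_ofReal (integral_nonneg fun z => by positivity) ?_
  rw [← lintegral_sq_of_mem_transportPlans hX hμ hν hπ]
  exact iInf₂_le _ hπ

theorem le_W2sq {r : ℝ} (h : ∀ π ∈ transportPlans μ ν, r ≤ ∫ z, ‖z.1 - z.2‖ ^ 2 ∂π) :
    r ≤ W2sq μ ν := by
  rw [W2sq, ← ENNReal.ofReal_le_iff_le_toReal (iInf_transportPlans_ne_top hX hμ hν)]
  refine le_iInf₂ fun π hπ => ?_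
  rw [lintegral_sq_of_mem_transportPlans hX hμ hν hπ]
  exact ENNReal.ofReal_le_ofReal (h π hπ)

/-- A mixture of plans is a plan between the mixtures, and its cost is the mixture of the costs. The
infima on the right are removed one at a time, dividing by `s` and `t`. -/
theorem W2sq_convexCombination_le {μ' : Measure (Space d)} [IsProbabilityMeasure μ']
    (hμ' : μ' Xᶜ = 0) {s t : ℝ} (hs : 0 < s) (ht : 0 < t) (hst : s + t = 1) :
    W2sq (ENNReal.ofReal s • μ + ENNReal.ofReal t • μ') ν ≤ s * W2sq μ ν + t * W2sq μ' ν := by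
  have hst' : ENNReal.ofReal s + ENNReal.ofReal t = 1 := by
    rw [← ENNReal.ofReal_add hs.le ht.le, hst, ENNReal.ofReal_one]
  have : IsProbabilityMeasure (ENNReal.ofReal s • μ + ENNReal.ofReal t • μ') := ⟨by simpa⟩
  have hcomb : (ENNReal.ofReal s • μ + ENNReal.ofReal t • μ') Xᶜ = 0 := by simp [hμ, hμ']
  rw [← sub_le_iff_le_add, ← div_le_iff₀' hs]
  refine le_W2sq hX hμ hν fun π hπ => ?_
  rw [div_le_iff₀' hs, sub_le_comm, ← div_le_iff₀' ht]
  refine le_W2sq hX hμ' hν fun π' hπ' => ?_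
  rw [div_le_iff₀' ht, sub_le_iff_le_add']
  have hmem : ENNReal.ofReal s • π + ENNReal.ofReal t • π' ∈
      transportPlans (ENNReal.ofReal s • μ + ENNReal.ofReal t • μ') ν := by
    constructor
    · rw [Measure.map_add _ _ measurable_fst, Measure.map_smul, Measure.map_smul, hπ.1, hπ'.1]
    · rw [Measure.map_add _ _ measurable_snd, Measure.map_smul, Measure.map_smul, hπ.2, hπ'.2,
        ← add_smul, hst', one_smul]
  refine (W2sq_le_integral hX hcomb hν hmem).trans (le_of_eq ?_)
  have hi := integrable_sq_of_mem_transportPlans hX hμ hν hπ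
  have hi' := integrable_sq_of_mem_transportPlans hX hμ' hν hπ'
  rw [integral_add_measure (hi.smul_measure ENNReal.ofReal_ne_top)
    (hi'.smul_measure ENNReal.ofReal_ne_top), integral_smul_measure, integral_smul_measure,
    ENNReal.toReal_ofReal hs.le, ENNReal.toReal_ofReal ht.le, smul_eq_mul, smul_eq_mul]

end Wasserstein

/-- Integrate the pointwise constraint against an arbitrary plan. The factor `1 / 2` is the one in
`cost`. -/
theorem weak_duality {X : Set (Space d)} (hX : IsCompact X) {μ ν : Measure (Space d)}
    [IsProbabilityMeasure μ] [IsProbabilityMeasure ν] (hμ : μ Xᶜ = 0) (hν : ν Xᶜ = 0)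
    {f g : Space d → ℝ} (hf : ContinuousOn f X) (hg : ContinuousOn g X)
    (hfg : ∀ x ∈ X, ∀ y ∈ X, f x + g y ≤ cost x y) :
    (∫ x in X, f x ∂μ) + (∫ y in X, g y ∂ν) ≤ W2sq μ ν / 2 := by
  rw [le_div_iff₀' two_pos]
  refine le_W2sq hX.isBounded hμ hν fun π hπ => ?_
  have hfi : Integrable f μ := by
    simpa [IntegrableOn, restrict_eq_of_measure_compl hμ] using hf.integrableOn_compact (μ := μ) hX
  have hgi : Integrable g ν := by
    simpa [IntegrableOn, restrict_eq_of_measure_compl hν] using hg.integrableOn_compact (μ := ν) hX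
  rw [restrict_eq_of_measure_compl hμ, restrict_eq_of_measure_compl hν]
  have hfi' := hfi
  have hgi' := hgi
  rw [← hπ.1] at hfi' ⊢
  rw [← hπ.2] at hgi' ⊢
  rw [integral_map measurable_fst.aemeasurable hfi'.aestronglyMeasurable,
    integral_map measurable_snd.aemeasurable hgi'.aestronglyMeasurable]
  have hfi'' : Integrable (fun z : Space d × Space d => f z.1) π :=
    hfi'.comp_measurable measurable_fst
  have hgi'' : Integrable (fun z : Space d × Space d => g z.2) π :=
    hgi'.comp_measurable measurable_snd
  rw [← integral_add hfi'' hgi'', ← integral_const_mul]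
  refine integral_mono_ae ((hfi''.add hgi'').const_mul 2)
    (integrable_sq_of_mem_transportPlans hX.isBounded hμ hν hπ) ?_
  filter_upwards [ae_mem_of_mem_transportPlans hμ hν hπ] with z hz
  have := hfg _ hz.1 _ hz.2
  simp only [cost] at this
  change 2 * (f z.1 + g z.2) ≤ _
  linarith

/-! ### The `c`-transform -/

theorem cost_comm (x y : Space d) : cost x y = cost y x := by
  rw [cost, cost, norm_sub_rev]

theorem continuous_cost : Continuous fun z : Space d × Space d => cost z.1 z.2 := by
  unfold cost
  fun_prop

/-- Factor the difference of squares: one factor is at most `dist x x'`, the other at most twice the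
diameter. -/
theorem cost_le_cost_add {X : Set (Space d)} (hX : Bornology.IsBounded X) {x x' y : Space d}
    (hx : x ∈ X) (hx' : x' ∈ X) (hy : y ∈ X) :
    cost x y ≤ cost x' y + Metric.diam X * dist x x' := by
  simp only [cost, ← dist_eq_norm]
  have h1 := dist_triangle x x' y
  have h2 := Metric.dist_le_diam_of_mem hX hx hy
  have h3 := Metric.dist_le_diam_of_mem hX hx' hy
  have h4 : 0 ≤ dist x x' := dist_nonneg
  have h5 : 0 ≤ dist x' y := dist_nonneg
  have h6 : 0 ≤ dist x y := dist_nonneg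
  have h7 : (dist x y - dist x' y) * (dist x y + dist x' y)
      ≤ dist x x' * (dist x y + dist x' y) :=
    mul_le_mul_of_nonneg_right (by linarith) (by linarith)
  have h8 : dist x x' * (dist x y + dist x' y) ≤ dist x x' * (2 * Metric.diam X) :=
    mul_le_mul_of_nonneg_left (by linarith) h4
  nlinarith

section CTransform

variable {X : Set (Space d)} (hX : IsCompact X) {f : Space d → ℝ} (hf : ContinuousOn f X)

include hX hf

theorem bddBelow_cost_sub (y : Space d) :
    BddBelow (Set.range fun x : X => cost (x : Space d) y - f x) := by
  have h : ContinuousOn (fun x => cost x y - f x) X :=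
    (continuous_cost.comp (Continuous.prodMk_left y)).continuousOn.sub hf
  have := (hX.image_of_continuousOn h).bddBelow
  rwa [Set.image_eq_range] at this

theorem add_cTransform_le {x : Space d} (hx : x ∈ X) (y : Space d) :
    f x + cTransform X f y ≤ cost x y := by
  have h : cTransform X f y ≤ cost x y - f x := ciInf_le (bddBelow_cost_sub hX hf y) ⟨x, hx⟩
  linarith

omit hX hf in
theorem le_cTransform (hne : X.Nonempty) {r : ℝ} {y : Space d}
    (h : ∀ x ∈ X, f x + r ≤ cost x y) : r ≤ cTransform X f y := by
  have := hne.to_subtype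
  refine le_ciInf fun x => ?_
  linarith [h x x.2]

theorem lipschitzOnWith_cTransform (hne : X.Nonempty) :
    LipschitzOnWith (Metric.diam X).toNNReal (cTransform X f) X := by
  refine LipschitzOnWith.of_le_add_mul _ fun y hy y' hy' => ?_
  rw [Real.coe_toNNReal _ Metric.diam_nonneg, ← sub_le_iff_le_add]
  refine le_cTransform hne fun x hx => ?_
  have h1 := add_cTransform_le hX hf hx y
  have h2 := cost_le_cost_add hX.isBounded hy hy' hx
  rw [cost_comm y x, cost_comm y' x] at h2
  linarith

theorem isCConcaveOn_cTransform (hne : X.Nonempty) : IsCConcaveOn X (cTransform X f) := by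
  have := hne.to_subtype
  refine ⟨f, fun x _ => ?_⟩
  have h := isGLB_ciInf (bddBelow_cost_sub hX hf x)
  rw [Set.image_eq_range]
  simp_rw [cost_comm x]
  exact h

theorem le_cTransform_cTransform (hne : X.Nonempty) {x : Space d} (hx : x ∈ X) :
    f x ≤ cTransform X (cTransform X f) x :=
  le_cTransform hne fun y _ => by
    rw [add_comm, cost_comm]
    exact add_cTransform_le hX hf hx y

/-- The double `c`-transform of an optimal dual pair is a Kantorovich potential. -/
theorem isKantorovichPotential_of_optimal (hne : X.Nonempty) {g : Space d → ℝ}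
    (hg : ContinuousOn g X) (hfg : ∀ x ∈ X, ∀ y ∈ X, f x + g y ≤ cost x y)
    {μ ν : Measure (Space d)} [IsProbabilityMeasure μ] [IsProbabilityMeasure ν]
    (hμ : μ Xᶜ = 0) (hν : ν Xᶜ = 0)
    (hopt : W2sq μ ν / 2 ≤ (∫ x in X, f x ∂μ) + ∫ y in X, g y ∂ν) :
    IsKantorovichPotential X μ ν (cTransform X (cTransform X f)) ∧
      ∫ x in X, cTransform X (cTransform X f) x ∂μ = ∫ x in X, f x ∂μ := by
  set ψ := cTransform X f with hψ
  set φ := cTransform X ψ with hφ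
  have hψc : ContinuousOn ψ X := (lipschitzOnWith_cTransform hX hf hne).continuousOn
  have hφc : ContinuousOn φ X := (lipschitzOnWith_cTransform hX hψc hne).continuousOn
  have hfφ : ∀ x ∈ X, f x ≤ φ x := fun x hx => le_cTransform_cTransform hX hf hne hx
  have hχc : ContinuousOn (cTransform X φ) X :=
    (lipschitzOnWith_cTransform hX hφc hne).continuousOn
  have hgχ : ∀ y ∈ X, g y ≤ cTransform X φ y := fun y hy =>
    (le_cTransform hne fun x hx => hfg x hx y hy).trans
      (le_cTransform_cTransform hX hψc hne hy)
  have h1 : ∫ x in X, f x ∂μ ≤ ∫ x in X, φ x ∂μ :=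
    setIntegral_mono_on (hf.integrableOn_compact hX) (hφc.integrableOn_compact hX)
      hX.measurableSet hfφ
  have h2 : ∫ y in X, g y ∂ν ≤ ∫ y in X, cTransform X φ y ∂ν :=
    setIntegral_mono_on (hg.integrableOn_compact hX) (hχc.integrableOn_compact hX)
      hX.measurableSet hgχ
  -- Passing to transforms can only raise both integrals, while weak duality caps their sum at the
  -- value `(f, g)` already reaches. Hence nothing changes, neither the total nor the first
  -- integral.
  have h3 : (∫ x in X, φ x ∂μ) + ∫ y in X, cTransform X φ y ∂ν ≤ W2sq μ ν / 2 :=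
    weak_duality hX hμ hν hφc hχc fun x hx y _ => add_cTransform_le hX hφc hx y
  refine ⟨⟨isCConcaveOn_cTransform hX hψc hne, fun f' g' hf' hg' hfg' => ?_⟩, by linarith⟩
  have h4 := weak_duality hX hμ hν hf' hg' hfg'
  linarith

end CTransform

end Muskat

namespace Muskat

variable {d : ℕ}

/-! ### The Gaussian kernel and its convolutions -/

/-- The value `K_ε(0)`. -/
noncomputable def kernelBound (d : ℕ) (σ ε : ℝ) : ℝ :=
  σ * Real.sqrt (2 * Real.pi / ε) * (1 / (4 * Real.pi * ε) ^ ((d : ℝ) / 2))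

theorem kernelK_eq (σ ε : ℝ) (x : Space d) :
    kernelK σ ε x = kernelBound d σ ε * Real.exp (-‖x‖ ^ 2 / (4 * ε)) := by
  rw [kernelK, heatKernel, kernelBound]
  ring

theorem kernelK_sub_comm (σ ε : ℝ) (x y : Space d) :
    kernelK σ ε (x - y) = kernelK σ ε (y - x) := by
  rw [kernelK_eq, kernelK_eq, norm_sub_rev]

theorem continuous_kernelK (σ ε : ℝ) : Continuous (kernelK σ ε : Space d → ℝ) := by
  have : (kernelK σ ε : Space d → ℝ) =
      fun x => kernelBound d σ ε * Real.exp (-‖x‖ ^ 2 / (4 * ε)) := funext (kernelK_eq σ ε)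
  rw [this]
  fun_prop

theorem abs_kernelK_le (σ : ℝ) {ε : ℝ} (hε : 0 < ε) (x : Space d) :
    |kernelK σ ε x| ≤ |kernelBound d σ ε| := by
  rw [kernelK_eq, abs_mul, abs_of_pos (Real.exp_pos _)]
  refine mul_le_of_le_one_right (abs_nonneg _) (Real.exp_le_one_iff.2 ?_)
  rw [neg_div]
  exact neg_nonpos.2 (by positivity)

theorem hasGradientAt_kernelK (σ ε : ℝ) (x : Space d) :
    HasGradientAt (kernelK σ ε) ((-kernelK σ ε x / (2 * ε)) • x) x := by
  rw [hasGradientAt_iff_hasFDerivAt]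
  have h1 : HasFDerivAt (fun x : Space d => ‖x‖ ^ 2) (2 • (innerSL ℝ) x) x :=
    (hasStrictFDerivAt_norm_sq x).hasFDerivAt
  have h2 : HasFDerivAt (fun x : Space d => -‖x‖ ^ 2 / (4 * ε))
      ((-1 / (4 * ε)) • (2 • (innerSL ℝ) x)) x := by
    have := h1.const_mul (-1 / (4 * ε))
    refine this.congr_of_eventuallyEq (Filter.Eventually.of_forall fun y => ?_)
    simp only
    ring
  have h3 := (h2.exp).const_mul (kernelBound d σ ε)
  have : (kernelK σ ε : Space d → ℝ) =
      fun x => kernelBound d σ ε * Real.exp (-‖x‖ ^ 2 / (4 * ε)) := funext (kernelK_eq σ ε)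
  rw [this]
  refine h3.congr_fderiv (ContinuousLinearMap.ext fun v => ?_)
  simp only [InnerProductSpace.toDual_apply_apply, inner_smul_left, smul_apply,
    innerSL_apply_apply, smul_eq_mul, nsmul_eq_mul, conj_trivial]
  -- For `ε = 0` the divisions give `0` and both sides vanish.
  by_cases hε : ε = 0
  · simp [hε]
  · push_cast
    field_simp
    ring

theorem gradient_kernelK (σ ε : ℝ) (x : Space d) :
    gradient (kernelK σ ε) x = (-kernelK σ ε x / (2 * ε)) • x :=
  (hasGradientAt_kernelK σ ε x).gradient

theorem continuous_gradient_kernelK (σ ε : ℝ) :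
    Continuous (gradient (kernelK σ ε) : Space d → Space d) := by
  have : (gradient (kernelK σ ε) : Space d → Space d) =
      fun x => (-kernelK σ ε x / (2 * ε)) • x := funext (gradient_kernelK σ ε)
  rw [this]
  exact (((continuous_kernelK σ ε).neg).div_const _).smul continuous_id

/-- The gradient has norm `|K_ε(0)| exp(-s) ‖x‖ / (2ε)` with `s = ‖x‖² / (4ε)`. Use `exp s ≥ 1 + s`;
the factor `1 + 4ε`, not sharp, is chosen so that `(1 + s)(1 + 4ε)` contains `1 + ‖x‖²`, which
dominates `‖x‖`. -/
theorem exists_lipschitzWith_kernelK (σ : ℝ) {ε : ℝ} (hε : 0 < ε) :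
    ∃ L : NNReal, LipschitzWith L (kernelK σ ε : Space d → ℝ) := by
  have hM : 0 ≤ |kernelBound d σ ε| * (1 + 4 * ε) / (2 * ε) := by positivity
  refine ⟨(|kernelBound d σ ε| * (1 + 4 * ε) / (2 * ε)).toNNReal, lipschitzWith_of_nnnorm_fderiv_le (𝕜 := ℝ)
    (fun x => (hasGradientAt_kernelK σ ε x).hasFDerivAt.differentiableAt) fun x => ?_⟩
  rw [(hasGradientAt_kernelK σ ε x).hasFDerivAt.fderiv, ← NNReal.coe_le_coe, coe_nnnorm,
    LinearIsometryEquiv.norm_map, norm_smul, norm_div, norm_neg, Real.norm_eq_abs,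
    Real.norm_of_nonneg (by positivity : (0 : ℝ) ≤ 2 * ε), Real.coe_toNNReal _ hM, kernelK_eq, abs_mul,
    abs_of_pos (Real.exp_pos _), div_mul_eq_mul_div, mul_assoc]
  gcongr
  have h1 : 1 + ‖x‖ ^ 2 / (4 * ε) ≤ Real.exp (‖x‖ ^ 2 / (4 * ε)) := by
    rw [add_comm]; exact Real.add_one_le_exp _
  rw [neg_div, Real.exp_neg, inv_mul_le_iff₀ (Real.exp_pos _)]
  have h2 : ‖x‖ ≤ (1 + ‖x‖ ^ 2 / (4 * ε)) * (1 + 4 * ε) := by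
    have e : (1 + ‖x‖ ^ 2 / (4 * ε)) * (1 + 4 * ε)
        = 1 + 4 * ε + ‖x‖ ^ 2 / (4 * ε) + ‖x‖ ^ 2 := by field_simp; ring
    rw [e]
    have : 0 ≤ ‖x‖ ^ 2 / (4 * ε) := by positivity
    nlinarith [sq_nonneg (‖x‖ - 1)]
  exact h2.trans (mul_le_mul_of_nonneg_right h1 (by positivity))

/-! ### Regularity of `K_ε ⋆ ρ` and the bilinear form it defines -/

section Convolution

variable (σ : ℝ) {ε : ℝ} (hε : 0 < ε) {Ω : Set (Space d)} {ρ η : Space d → ℝ}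
  (hρ : IntegrableOn ρ Ω) (hη : IntegrableOn η Ω)

include hε hρ

theorem integrableOn_kernelK_mul (x : Space d) :
    IntegrableOn (fun y => kernelK σ ε (x - y) * ρ y) Ω := by
  refine Integrable.bdd_mul (c := |kernelBound d σ ε|) hρ ?_
    (Filter.Eventually.of_forall fun y => abs_kernelK_le σ hε _)
  exact ((continuous_kernelK σ ε).comp (continuous_const.sub continuous_id)).aestronglyMeasurable

theorem hasGradientAt_convK (x : Space d) :
    HasGradientAt (convK σ ε Ω ρ) (convGradK σ ε Ω ρ x) x := by
  obtain ⟨L, hL⟩ := exists_lipschitzWith_kernelK (d := d) σ hε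
  have hgrad : AEStronglyMeasurable (fun y => ρ y • gradient (kernelK σ ε) (x - y))
      (volume.restrict Ω) :=
    hρ.aestronglyMeasurable.smul ((continuous_gradient_kernelK σ ε).comp
      (continuous_const.sub continuous_id)).aestronglyMeasurable
  have key := hasFDerivAt_integral_of_dominated_loc_of_lip (𝕜 := ℝ) (μ := volume.restrict Ω)
    (F := fun x y => kernelK σ ε (x - y) * ρ y) (x₀ := x) (s := Set.univ)
    (F' := fun y => InnerProductSpace.toDual ℝ (Space d) (ρ y • gradient (kernelK σ ε) (x - y)))
    -- The Lipschitz bound enters through its absolute value, so the sign of `ρ` does not matter.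
    (bound := fun y => L * ρ y) Filter.univ_mem
    (Filter.Eventually.of_forall fun x => (integrableOn_kernelK_mul σ hε hρ x).aestronglyMeasurable)
    (integrableOn_kernelK_mul σ hε hρ x)
    ((LinearIsometryEquiv.continuous _).comp_aestronglyMeasurable hgrad)
    (Filter.Eventually.of_forall fun y => by
      refine (LipschitzWith.of_dist_le_mul fun a b => ?_).lipschitzOnWith
      rw [Real.dist_eq, ← sub_mul, abs_mul, Real.coe_nnabs, abs_mul, NNReal.abs_eq,
        mul_right_comm]
      have := hL.dist_le_mul (a - y) (b - y)
      rw [Real.dist_eq, dist_sub_right] at this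
      exact mul_le_mul_of_nonneg_right this (abs_nonneg _))
    (hρ.const_mul _)
    (Filter.Eventually.of_forall fun y => by
      have h1 : HasFDerivAt (fun x => kernelK σ ε (x - y))
          (InnerProductSpace.toDual ℝ (Space d) (gradient (kernelK σ ε) (x - y))) x := by
        rw [hasFDerivAt_comp_sub (f := kernelK σ ε), gradient_kernelK]
        exact (hasGradientAt_kernelK σ ε (x - y)).hasFDerivAt
      have h2 := h1.mul_const (ρ y)
      exact h2.congr_fderiv (ContinuousLinearMap.ext fun v => by
        simp))
  rw [hasGradientAt_iff_hasFDerivAt]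
  refine key.2.congr_fderiv (ContinuousLinearMap.ext fun v => ?_)
  rw [ContinuousLinearMap.integral_apply key.1]
  simp only [InnerProductSpace.toDual_apply_apply]
  have hi : IntegrableOn (fun y => ρ y • gradient (kernelK σ ε) (x - y)) Ω := by
    have := (LinearIsometryEquiv.integrable_comp_iff
      (InnerProductSpace.toDual ℝ (Space d))).1 key.1
    exact this
  simp_rw [real_inner_comm v]
  exact integral_inner hi v

theorem exists_lipschitzWith_convK : ∃ L : NNReal, LipschitzWith L (convK σ ε Ω ρ) := by
  obtain ⟨L, hL⟩ := exists_lipschitzWith_kernelK (d := d) σ hε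
  have hI : 0 ≤ ∫ y in Ω, |ρ y| := integral_nonneg fun y => abs_nonneg _
  refine ⟨L * (∫ y in Ω, |ρ y|).toNNReal, LipschitzWith.of_dist_le_mul fun a b => ?_⟩
  rw [Real.dist_eq, convK, convK, ← integral_sub (integrableOn_kernelK_mul σ hε hρ a)
    (integrableOn_kernelK_mul σ hε hρ b)]
  refine (abs_integral_le_integral_abs).trans ?_
  rw [NNReal.coe_mul, Real.coe_toNNReal _ hI, mul_right_comm, ← integral_const_mul]
  refine integral_mono ((integrableOn_kernelK_mul σ hε hρ a).sub
    (integrableOn_kernelK_mul σ hε hρ b)).abs (hρ.abs.const_mul _) fun y => ?_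
  simp only
  rw [← sub_mul, abs_mul]
  have := hL.dist_le_mul (a - y) (b - y)
  rw [Real.dist_eq, dist_sub_right] at this
  exact mul_le_mul_of_nonneg_right this (abs_nonneg _)

theorem abs_convK_le (x : Space d) :
    |convK σ ε Ω ρ x| ≤ |kernelBound d σ ε| * ∫ y in Ω, |ρ y| := by
  rw [convK, ← integral_const_mul]
  refine (abs_integral_le_integral_abs).trans
    (integral_mono (integrableOn_kernelK_mul σ hε hρ x).abs (hρ.abs.const_mul _) fun y => ?_)
  simp only
  rw [abs_mul]
  exact mul_le_mul_of_nonneg_right (abs_kernelK_le σ hε _) (abs_nonneg _)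

include hη

theorem integrableOn_convK_mul : IntegrableOn (fun x => convK σ ε Ω ρ x * η x) Ω := by
  obtain ⟨L, hL⟩ := exists_lipschitzWith_convK σ hε hρ
  exact Integrable.bdd_mul hη hL.continuous.aestronglyMeasurable
    (Filter.Eventually.of_forall fun x => abs_convK_le σ hε hρ x)

/-- Fubini and evenness of the kernel. Symmetry is what gives the two components the linearized
costs `K_ε ⋆ ρ₂` and `K_ε ⋆ ρ₁`. -/
theorem heatContent_comm : heatContent σ ε Ω ρ η = heatContent σ ε Ω η ρ := by
  have h1 : heatContent σ ε Ω ρ η =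
      ∫ x in Ω, ∫ y in Ω, kernelK σ ε (x - y) * ρ y * η x := by
    simp_rw [integral_mul_const]
    rfl
  have h2 : heatContent σ ε Ω η ρ =
      ∫ y in Ω, ∫ x in Ω, kernelK σ ε (x - y) * ρ y * η x := by
    simp_rw [mul_right_comm _ _ (η _), integral_mul_const, kernelK_sub_comm σ ε _ _]
    rfl
  rw [h1, h2]
  refine integral_integral_swap ?_
  have h3 : Integrable (fun z : Space d × Space d => η z.1 * ρ z.2)
      ((volume.restrict Ω).prod (volume.restrict Ω)) := hη.mul_prod hρ
  have h4 := Integrable.bdd_mul (f := fun z : Space d × Space d => kernelK σ ε (z.1 - z.2))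
    (c := |kernelBound d σ ε|) h3
    ((continuous_kernelK σ ε).comp (continuous_fst.sub continuous_snd)).aestronglyMeasurable
    (Filter.Eventually.of_forall fun z => abs_kernelK_le σ hε _)
  refine h4.congr (Filter.Eventually.of_forall fun z => ?_)
  simp only [Function.uncurry]
  ring

theorem convK_add_mul (s t : ℝ) (x : Space d) :
    convK σ ε Ω (fun y => s * ρ y + t * η y) x = s * convK σ ε Ω ρ x + t * convK σ ε Ω η x := by
  simp only [convK]
  rw [← integral_const_mul, ← integral_const_mul, ← integral_add
    ((integrableOn_kernelK_mul σ hε hρ x).const_mul s)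
    ((integrableOn_kernelK_mul σ hε hη x).const_mul t)]
  congr 1
  ext y
  ring

/-- Bilinearity of the heat content. -/
theorem heatContent_add_mul {ρ' η' : Space d → ℝ} (hρ' : IntegrableOn ρ' Ω)
    (hη' : IntegrableOn η' Ω) (s t : ℝ) :
    heatContent σ ε Ω (fun y => s * ρ y + t * η y) (fun y => s * ρ' y + t * η' y) =
      s ^ 2 * heatContent σ ε Ω ρ ρ' + s * t * heatContent σ ε Ω ρ η'
        + s * t * heatContent σ ε Ω η ρ' + t ^ 2 * heatContent σ ε Ω η η' := by
  have i1 := (integrableOn_convK_mul σ hε hρ hρ').const_mul (s ^ 2)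
  have i2 := (integrableOn_convK_mul σ hε hρ hη').const_mul (s * t)
  have i3 := (integrableOn_convK_mul σ hε hη hρ').const_mul (s * t)
  have i4 := (integrableOn_convK_mul σ hε hη hη').const_mul (t ^ 2)
  simp only [heatContent, convK_add_mul σ hε hρ hη]
  rw [← integral_const_mul, ← integral_const_mul, ← integral_const_mul, ← integral_const_mul,
    ← integral_add i1 i2, ← integral_add (by exact i1.add i2) i3,
    ← integral_add (by exact (i1.add i2).add i3) i4]
  refine integral_congr_ae (Filter.Eventually.of_forall fun y => ?_)
  simp only
  ring

end Convolution

end Muskat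

namespace Muskat

variable {d : ℕ}

/-! ### Densities -/

theorem IsProbDensity.integrableOn {Ω : Set (Space d)} {ρ : Space d → ℝ}
    (h : IsProbDensity Ω ρ) : IntegrableOn ρ Ω := by
  refine (lintegral_ofReal_ne_top_iff_integrable h.aemeasurable.aestronglyMeasurable h.nonneg).1 ?_
  rw [h.mass_one]
  exact ENNReal.one_ne_top

theorem IsProbDensity.isProbabilityMeasure {Ω : Set (Space d)} {ρ : Space d → ℝ}
    (h : IsProbDensity Ω ρ) : IsProbabilityMeasure (densityMeasure Ω ρ) := by
  refine ⟨?_⟩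
  rw [densityMeasure, withDensity_apply _ MeasurableSet.univ, Measure.restrict_univ]
  exact h.mass_one

theorem densityMeasure_absolutelyContinuous (Ω : Set (Space d)) (ρ : Space d → ℝ) :
    densityMeasure Ω ρ ≪ volume.restrict Ω :=
  withDensity_absolutelyContinuous _ _

theorem densityMeasure_compl_closure (Ω : Set (Space d)) (ρ : Space d → ℝ) :
    densityMeasure Ω ρ (closure Ω)ᶜ = 0 := by
  refine densityMeasure_absolutelyContinuous Ω ρ ?_
  rw [Measure.restrict_apply isClosed_closure.measurableSet.compl]
  have : (closure Ω)ᶜ ∩ Ω = ∅ := by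
    ext x
    simpa using fun h hx => h (subset_closure hx)
  rw [this, measure_empty]

theorem IsProbDensity.integral_densityMeasure {Ω : Set (Space d)} {ρ : Space d → ℝ}
    (h : IsProbDensity Ω ρ) (f : Space d → ℝ) :
    ∫ x, f x ∂densityMeasure Ω ρ = ∫ x in Ω, f x * ρ x := by
  rw [densityMeasure, integral_withDensity_eq_integral_toReal_smul₀ h.aemeasurable.ennreal_ofReal
    (Filter.Eventually.of_forall fun x => ENNReal.ofReal_lt_top)]
  refine integral_congr_ae ?_
  filter_upwards [h.nonneg] with x hx
  rw [ENNReal.toReal_ofReal hx, smul_eq_mul, mul_comm]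

theorem IsProbDensity.setIntegral_closure {Ω : Set (Space d)} {ρ : Space d → ℝ}
    (h : IsProbDensity Ω ρ) (f : Space d → ℝ) :
    ∫ x in closure Ω, f x ∂densityMeasure Ω ρ = ∫ x in Ω, f x * ρ x := by
  rw [restrict_eq_of_measure_compl (densityMeasure_compl_closure Ω ρ),
    h.integral_densityMeasure f]

theorem densityMeasure_add_mul {Ω : Set (Space d)} {ρ η : Space d → ℝ} (hρ : IsProbDensity Ω ρ)
    (hη : IsProbDensity Ω η) {s t : ℝ} (hs : 0 ≤ s) (ht : 0 ≤ t) :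
    densityMeasure Ω (fun x => s * ρ x + t * η x) =
      ENNReal.ofReal s • densityMeasure Ω ρ + ENNReal.ofReal t • densityMeasure Ω η := by
  simp only [densityMeasure]
  refine Measure.ext fun A hA => ?_
  simp only [Measure.add_apply, Measure.smul_apply, withDensity_apply _ hA, smul_eq_mul]
  rw [← lintegral_const_mul' _ _ ENNReal.ofReal_ne_top,
    ← lintegral_const_mul' _ _ ENNReal.ofReal_ne_top,
    ← lintegral_add_left' ((hρ.aemeasurable.ennreal_ofReal.const_mul _).restrict)]
  refine lintegral_congr_ae (ae_restrict_of_ae ?_)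
  filter_upwards [hρ.nonneg, hη.nonneg] with x hx hx'
  rw [ENNReal.ofReal_add (mul_nonneg hs hx) (mul_nonneg ht hx'), ENNReal.ofReal_mul hs,
    ENNReal.ofReal_mul ht]

theorem IsProbDensity.add_mul {Ω : Set (Space d)} {ρ η : Space d → ℝ} (hρ : IsProbDensity Ω ρ)
    (hη : IsProbDensity Ω η) {s t : ℝ} (hs : 0 ≤ s) (ht : 0 ≤ t) (hst : s + t = 1) :
    IsProbDensity Ω (fun x => s * ρ x + t * η x) where
  aemeasurable := (hρ.aemeasurable.const_mul s).add (hη.aemeasurable.const_mul t)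
  nonneg := by
    filter_upwards [hρ.nonneg, hη.nonneg] with x hx hx'
    positivity
  mass_one := by
    have h1 := hρ.isProbabilityMeasure
    have h2 := hη.isProbabilityMeasure
    have h : densityMeasure Ω (fun x => s * ρ x + t * η x) Set.univ = 1 := by
      rw [densityMeasure_add_mul hρ hη hs ht]
      simp [← ENNReal.ofReal_add hs ht, hst]
    rwa [densityMeasure, withDensity_apply _ MeasurableSet.univ, Measure.restrict_univ] at h

theorem Admissible.add_mul {Ω : Set (Space d)} {ρ₁ ρ₂ η₁ η₂ : Space d → ℝ}
    (hρ : Admissible Ω ρ₁ ρ₂) (hη : Admissible Ω η₁ η₂) {s t : ℝ} (hs : 0 ≤ s) (ht : 0 ≤ t)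
    (hst : s + t = 1) :
    Admissible Ω (fun x => s * ρ₁ x + t * η₁ x) (fun x => s * ρ₂ x + t * η₂ x) where
  left := hρ.left.add_mul hη.left hs ht hst
  right := hρ.right.add_mul hη.right hs ht hst
  sum_eq_one := by
    filter_upwards [hρ.sum_eq_one, hη.sum_eq_one] with x hx hx'
    linear_combination s * hx + t * hx' + hst

theorem integrableOn_mul_of_lipschitzOn {Ω : Set (Space d)} (hΩ : IsOpen Ω)
    (hb : Bornology.IsBounded Ω) {f ρ : Space d → ℝ} {L : NNReal} (hf : LipschitzOnWith L f Ω)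
    (hρ : IntegrableOn ρ Ω) : IntegrableOn (fun x => f x * ρ x) Ω := by
  obtain ⟨f', hf', heq⟩ := hf.extend_real
  obtain ⟨M, hM⟩ := (hf'.isBounded_image hb).exists_norm_le
  refine Integrable.bdd_mul (c := M) hρ (hf.continuousOn.aestronglyMeasurable hΩ.measurableSet) ?_
  filter_upwards [ae_restrict_mem hΩ.measurableSet] with x hx
  rw [heq hx]
  exact hM _ ⟨x, hx, rfl⟩

/-! ### The linearised minimisation problem -/

theorem nonneg_of_forall_add_mul_nonneg {a b : ℝ} (h : ∀ t : ℝ, 0 < t → t < 1 → 0 ≤ a + t * b) :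
    0 ≤ a := by
  have hlim : Filter.Tendsto (fun t : ℝ => a + t * b) (nhdsWithin 0 (Set.Ioi 0))
      (nhds (a + 0 * b)) :=
    (Continuous.tendsto (by fun_prop) 0).mono_left nhdsWithin_le_nhds
  rw [zero_mul, add_zero] at hlim
  refine ge_of_tendsto hlim ?_
  filter_upwards [Ioo_mem_nhdsGT one_pos] with t ht
  exact h t ht.1 ht.2

/-- A minimiser of the one-step functional minimises its convexification at the minimiser. -/
theorem IsStepMinimizer.linearized_le {Ω : Set (Space d)} (hΩ : IsOpen Ω)
    (hb : Bornology.IsBounded Ω) {σ ε τ b₁ b₂ : ℝ} (hε : 0 < ε) (hτ : 0 < τ)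
    (hb₁ : 0 < b₁) (hb₂ : 0 < b₂) {Φ₁ Φ₂ : Space d → ℝ} {L₁ L₂ : NNReal}
    (hΦ₁ : LipschitzOnWith L₁ Φ₁ Ω) (hΦ₂ : LipschitzOnWith L₂ Φ₂ Ω)
    {μ₁ μ₂ : Measure (Space d)} [IsProbabilityMeasure μ₁] [IsProbabilityMeasure μ₂]
    (hμ₁ : μ₁ (closure Ω)ᶜ = 0) (hμ₂ : μ₂ (closure Ω)ᶜ = 0)
    {ρ₁ ρ₂ : Space d → ℝ} (hmin : IsStepMinimizer σ ε τ b₁ b₂ Φ₁ Φ₂ Ω μ₁ μ₂ ρ₁ ρ₂)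
    {η₁ η₂ : Space d → ℝ} (hη : Admissible Ω η₁ η₂) :
    (∫ x in Ω, (convK σ ε Ω ρ₂ x + Φ₁ x) * ρ₁ x) + (∫ x in Ω, (convK σ ε Ω ρ₁ x + Φ₂ x) * ρ₂ x)
        + b₁ / τ * (W2sq (densityMeasure Ω ρ₁) μ₁ / 2)
        + b₂ / τ * (W2sq (densityMeasure Ω ρ₂) μ₂ / 2) ≤
      (∫ x in Ω, (convK σ ε Ω ρ₂ x + Φ₁ x) * η₁ x) + (∫ x in Ω, (convK σ ε Ω ρ₁ x + Φ₂ x) * η₂ x)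
        + b₁ / τ * (W2sq (densityMeasure Ω η₁) μ₁ / 2)
        + b₂ / τ * (W2sq (densityMeasure Ω η₂) μ₂ / 2) := by
  obtain ⟨hρ, hmin⟩ := hmin
  have iρ₁ := hρ.left.integrableOn
  have iρ₂ := hρ.right.integrableOn
  have iη₁ := hη.left.integrableOn
  have iη₂ := hη.right.integrableOn
  have pρ₁ := hρ.left.isProbabilityMeasure
  have pρ₂ := hρ.right.isProbabilityMeasure
  have pη₁ := hη.left.isProbabilityMeasure
  have pη₂ := hη.right.isProbabilityMeasure
  have hbX := hb.closure
  have split : ∀ {f Φ ρ : Space d → ℝ} {L : NNReal}, IntegrableOn f Ω → LipschitzOnWith L Φ Ω →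
      IntegrableOn ρ Ω → ∫ x in Ω, (convK σ ε Ω f x + Φ x) * ρ x =
        heatContent σ ε Ω f ρ + ∫ x in Ω, Φ x * ρ x := by
    intro f Φ ρ L hf hΦ hρ
    simp only [heatContent, _root_.add_mul]
    exact integral_add (integrableOn_convK_mul σ hε hf hρ)
      (integrableOn_mul_of_lipschitzOn hΩ hb hΦ hρ)
  have lin : ∀ {Φ ρ η : Space d → ℝ} {L : NNReal}, LipschitzOnWith L Φ Ω →
      IntegrableOn ρ Ω → IntegrableOn η Ω → ∀ s t : ℝ,
      ∫ x in Ω, Φ x * (s * ρ x + t * η x) =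
        s * (∫ x in Ω, Φ x * ρ x) + t * ∫ x in Ω, Φ x * η x := by
    intro Φ ρ η L hΦ hρ hη s t
    rw [← integral_const_mul, ← integral_const_mul, ← integral_add
      ((integrableOn_mul_of_lipschitzOn hΩ hb hΦ hρ).const_mul s)
      ((integrableOn_mul_of_lipschitzOn hΩ hb hΦ hη).const_mul t)]
    congr 1
    ext x
    ring
  rw [split iρ₂ hΦ₁ iρ₁, split iρ₁ hΦ₂ iρ₂, split iρ₂ hΦ₁ iη₁, split iρ₁ hΦ₂ iη₂,
    heatContent_comm σ hε iρ₂ iρ₁, heatContent_comm σ hε iρ₂ iη₁]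
  set H := heatContent σ ε Ω ρ₁ ρ₂ with hH
  set H' := heatContent σ ε Ω η₁ η₂ with hH'
  set H₁ := heatContent σ ε Ω ρ₁ η₂ with hH₁
  set H₂ := heatContent σ ε Ω η₁ ρ₂ with hH₂
  rw [← sub_nonneg]
  -- Along `(1 - t)ρ + tη` the heat content is quadratic in `t` with leading coefficient `H - H₁ -
  -- H₂ + H'`. After division by `t` that term is the only one of order `t`, and it disappears in
  -- the limit.
  refine nonneg_of_forall_add_mul_nonneg (b := H - H₁ - H₂ + H') fun t ht0 ht1 => ?_
  have hs : 0 < 1 - t := by linarith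
  have key := hmin _ _ (hρ.add_mul hη hs.le ht0.le (by ring))
  simp only [stepEnergy, potentialEnergy] at key
  rw [heatContent_add_mul σ hε iρ₁ iη₁ iρ₂ iη₂, lin hΦ₁ iρ₁ iη₁, lin hΦ₂ iρ₂ iη₂,
    densityMeasure_add_mul hρ.left hη.left hs.le ht0.le,
    densityMeasure_add_mul hρ.right hη.right hs.le ht0.le,
    ← hH, ← hH', ← hH₁, ← hH₂] at key
  have w₁ := W2sq_convexCombination_le hbX (densityMeasure_compl_closure Ω ρ₁) hμ₁
    (densityMeasure_compl_closure Ω η₁) hs ht0 (by ring)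
  have w₂ := W2sq_convexCombination_le hbX (densityMeasure_compl_closure Ω ρ₂) hμ₂
    (densityMeasure_compl_closure Ω η₂) hs ht0 (by ring)
  have w₁' := mul_le_mul_of_nonneg_left w₁ (by positivity : 0 ≤ b₁ / (2 * τ))
  have w₂' := mul_le_mul_of_nonneg_left w₂ (by positivity : 0 ≤ b₂ / (2 * τ))
  have e₁ : b₁ / τ = 2 * (b₁ / (2 * τ)) := by field_simp
  have e₂ : b₂ / τ = 2 * (b₂ / (2 * τ)) := by field_simp
  rw [e₁, e₂]
  refine nonneg_of_mul_nonneg_right ?_ ht0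
  nlinarith [key, w₁', w₂']

end Muskat

namespace Muskat

variable {d : ℕ}

/-! ### The transport problem for a pair of targets -/

/-- Each measure is dominated by Lebesgue measure on `Ω`, so both have Radon–Nikodym densities;
these add up to the density of Lebesgue measure with respect to itself. -/
theorem exists_admissible_of_measure_add {Ω : Set (Space d)} (hΩ : volume Ω ≠ ⊤)
    (m₁ m₂ : Measure (Space d)) [IsProbabilityMeasure m₁] [IsProbabilityMeasure m₂]
    (hm : m₁ + m₂ = volume.restrict Ω) :
    ∃ η₁ η₂ : Space d → ℝ, Admissible Ω η₁ η₂ ∧ densityMeasure Ω η₁ = m₁ ∧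
      densityMeasure Ω η₂ = m₂ := by
  have : IsFiniteMeasure (volume.restrict Ω) := ⟨by simpa using hΩ.lt_top⟩
  have density : ∀ (m : Measure (Space d)) [IsProbabilityMeasure m], m ≤ volume.restrict Ω →
      densityMeasure Ω (fun x => (m.rnDeriv (volume.restrict Ω) x).toReal) = m ∧
      IsProbDensity Ω (fun x => (m.rnDeriv (volume.restrict Ω) x).toReal) := by
    intro m _ hle
    have h1 : densityMeasure Ω (fun x => (m.rnDeriv (volume.restrict Ω) x).toReal) = m := by
      rw [densityMeasure]
      refine Eq.trans (withDensity_congr_ae ?_)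
        (Measure.withDensity_rnDeriv_eq m _ (Measure.absolutelyContinuous_of_le hle))
      filter_upwards [m.rnDeriv_lt_top (volume.restrict Ω)] with x hx
      exact ENNReal.ofReal_toReal hx.ne
    refine ⟨h1, ⟨(Measure.measurable_rnDeriv _ _).ennreal_toReal.aemeasurable,
      Filter.Eventually.of_forall fun x => ENNReal.toReal_nonneg, ?_⟩⟩
    have h2 : densityMeasure Ω (fun x => (m.rnDeriv (volume.restrict Ω) x).toReal) Set.univ = 1 := by
      rw [h1, measure_univ]
    rwa [densityMeasure, withDensity_apply _ MeasurableSet.univ, Measure.restrict_univ] at h2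
  obtain ⟨e₁, p₁⟩ := density m₁ (hm ▸ Measure.le_add_right le_rfl)
  obtain ⟨e₂, p₂⟩ := density m₂ (hm ▸ Measure.le_add_left le_rfl)
  refine ⟨_, _, ⟨p₁, p₂, ?_⟩, e₁, e₂⟩
  have h := Measure.rnDeriv_add m₁ m₂ (volume.restrict Ω)
  rw [hm] at h
  filter_upwards [h, Measure.rnDeriv_self (volume.restrict Ω),
    m₁.rnDeriv_lt_top (volume.restrict Ω), m₂.rnDeriv_lt_top (volume.restrict Ω)]
    with x h1 h2 h3 h4
  rw [← ENNReal.toReal_add h3.ne h4.ne]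
  rw [Pi.add_apply, h2] at h1
  rw [← h1, ENNReal.toReal_one]

/-! ### Splitting a plan according to the label of its target -/

section Component

variable {X : Set (Space d)}

/-- The part of a plan that is sent to the copy of `X` labelled by `b`, as a measure on
`ℝ^d × ℝ^d`. -/
noncomputable def planComponent (π : Measure (X × (X × Bool))) (b : Bool) :
    Measure (Space d × Space d) :=
  (π.restrict {z | z.2.2 = b}).map fun z => ((z.1 : Space d), (z.2.1 : Space d))

theorem measurable_planProj :
    Measurable fun z : X × (X × Bool) => ((z.1 : Space d), (z.2.1 : Space d)) := by
  fun_prop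

theorem measurableSet_label (b : Bool) : MeasurableSet {z : X × (X × Bool) | z.2.2 = b} :=
  (measurable_snd.comp measurable_snd) (MeasurableSet.singleton b)

/-- The disjoint union of two measures on `X`. -/
noncomputable def sumMeasure (ν₁ ν₂ : Measure X) : Measure (X × Bool) :=
  ν₁.map (fun y => (y, false)) + ν₂.map (fun y => (y, true))

instance (ν₁ ν₂ : Measure X) [IsFiniteMeasure ν₁] [IsFiniteMeasure ν₂] :
    IsFiniteMeasure (sumMeasure ν₁ ν₂) := by
  unfold sumMeasure
  infer_instance

theorem planComponent_map_snd {π : Measure (X × (X × Bool))} {ν₁ ν₂ : Measure X}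
    (h : π.map Prod.snd = sumMeasure ν₁ ν₂) (b : Bool) :
    (planComponent π b).map Prod.snd = (bif b then ν₂ else ν₁).map Subtype.val := by
  refine Measure.ext fun A hA => ?_
  have hA' : MeasurableSet {y : X × Bool | (y.1 : Space d) ∈ A ∧ y.2 = b} :=
    ((measurable_subtype_coe.comp measurable_fst) hA).inter
      (measurable_snd (MeasurableSet.singleton b))
  rw [Measure.map_apply measurable_snd hA, planComponent,
    Measure.map_apply measurable_planProj (measurable_snd hA),
    Measure.restrict_apply (measurable_planProj (measurable_snd hA)),
    Measure.map_apply measurable_subtype_coe hA]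
  have h1 := congrArg (fun m => m {y : X × Bool | (y.1 : Space d) ∈ A ∧ y.2 = b}) h
  simp only [sumMeasure, Measure.add_apply] at h1
  rw [Measure.map_apply measurable_snd hA', Measure.map_apply (by fun_prop) hA',
    Measure.map_apply (by fun_prop) hA'] at h1
  refine Eq.trans ?_ (h1.trans ?_)
  · rfl
  · cases b <;> simp [Set.preimage]

/-- The labels partition the plan, so no mass is lost. With Lebesgue measure as source this becomes
the constraint `η₁ + η₂ = 1`. -/
theorem planComponent_add_map_fst (π : Measure (X × (X × Bool))) :
    (planComponent π false).map Prod.fst + (planComponent π true).map Prod.fst =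
      (π.map Prod.fst).map Subtype.val := by
  have hcompl : {z : X × (X × Bool) | z.2.2 = true} = {z | z.2.2 = false}ᶜ := by
    ext z
    simp
  rw [← Measure.map_add _ _ measurable_fst, planComponent, planComponent,
    ← Measure.map_add _ _ measurable_planProj, hcompl,
    Measure.restrict_add_restrict_compl (measurableSet_label false),
    Measure.map_map measurable_fst measurable_planProj,
    Measure.map_map measurable_subtype_coe measurable_fst]
  rfl

theorem integral_planComponent_add {π : Measure (X × (X × Bool))} [IsFiniteMeasure π]
    {C : X × (X × Bool) → ℝ} (hC : Integrable C π) {F : Bool → Space d × Space d → ℝ}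
    (hF : ∀ b, Continuous (F b))
    (hCF : ∀ z : X × (X × Bool), C z = F z.2.2 ((z.1 : Space d), (z.2.1 : Space d))) :
    ∫ z, C z ∂π = ∫ p, F false p ∂planComponent π false + ∫ p, F true p ∂planComponent π true := by
  have hcompl : {z : X × (X × Bool) | z.2.2 = true} = {z | z.2.2 = false}ᶜ := by
    ext z
    simp
  have key : ∀ b, ∫ p, F b p ∂planComponent π b = ∫ z in {z | z.2.2 = b}, C z ∂π := by
    intro b
    rw [planComponent, integral_map measurable_planProj.aemeasurable
      (hF b).measurable.aestronglyMeasurable]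
    refine setIntegral_congr_fun (measurableSet_label b) fun z hz => ?_
    have hz' : z.2.2 = b := hz
    simp only [hCF z, hz']
  rw [key, key, hcompl, integral_add_compl (measurableSet_label false) hC]

end Component

/-- Duality for the transport of Lebesgue measure on `Ω` onto a pair of targets `μ₁`, `μ₂`, with
costs `A_i(x) + κ_i c(x, y)`. -/
theorem exists_dual_potentials_pair {Ω : Set (Space d)} (hΩ : IsOpen Ω)
    (hb : Bornology.IsBounded Ω) (hvol : volume Ω = 2)
    (μ₁ μ₂ : Measure (Space d)) [IsProbabilityMeasure μ₁] [IsProbabilityMeasure μ₂]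
    (hμ₁ : μ₁ (closure Ω)ᶜ = 0) (hμ₂ : μ₂ (closure Ω)ᶜ = 0) {A₁ A₂ : Space d → ℝ}
    {L₁ L₂ : NNReal} (hA₁ : LipschitzWith L₁ A₁) (hA₂ : LipschitzWith L₂ A₂) {κ₁ κ₂ : ℝ}
    (hκ₁ : 0 < κ₁) (hκ₂ : 0 < κ₂) :
    ∃ u v₁ v₂ : Space d → ℝ, (∃ L, LipschitzOnWith L u (closure Ω)) ∧
      ContinuousOn v₁ (closure Ω) ∧ ContinuousOn v₂ (closure Ω) ∧
      (∀ x ∈ closure Ω, ∀ y ∈ closure Ω, u x + v₁ y ≤ A₁ x + κ₁ * cost x y) ∧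
      (∀ x ∈ closure Ω, ∀ y ∈ closure Ω, u x + v₂ y ≤ A₂ x + κ₂ * cost x y) ∧
      ∃ η₁ η₂ : Space d → ℝ, Admissible Ω η₁ η₂ ∧
        (∫ x in Ω, A₁ x * η₁ x) + (∫ x in Ω, A₂ x * η₂ x)
          + κ₁ * (W2sq (densityMeasure Ω η₁) μ₁ / 2) + κ₂ * (W2sq (densityMeasure Ω η₂) μ₂ / 2) ≤
        (∫ x in Ω, u x) + (∫ y in closure Ω, v₁ y ∂μ₁) + ∫ y in closure Ω, v₂ y ∂μ₂ := by
  set X : Set (Space d) := closure Ω with hX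
  have hXb : Bornology.IsBounded X := hb.closure
  have hXc : IsCompact X := hb.isCompact_closure
  have hXm : MeasurableSet X := isClosed_closure.measurableSet
  have : CompactSpace X := isCompact_iff_compactSpace.1 hXc
  have hne : X.Nonempty := by
    rw [hX, closure_nonempty_iff, Set.nonempty_iff_ne_empty]
    rintro rfl
    simp at hvol
  have : Nonempty X := hne.to_subtype
  have hfin : IsFiniteMeasure (volume.restrict Ω) := ⟨by simp [hvol]⟩
  have hemb := MeasurableEmbedding.subtype_coe hXm
  have hfinc : ∀ m : Measure (Space d), IsFiniteMeasure m →
      IsFiniteMeasure (m.comap (Subtype.val : X → Space d)) := fun m _ =>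
    ⟨by rw [hemb.comap_apply]; exact measure_lt_top _ _⟩
  have hmapc : ∀ m : Measure (Space d), m Xᶜ = 0 →
      (m.comap (Subtype.val : X → Space d)).map Subtype.val = m := fun m hm => by
    rw [map_comap_subtype_coe hXm, restrict_eq_of_measure_compl hm]
  have hΩX : volume.restrict Ω Xᶜ = 0 := by
    rw [Measure.restrict_apply hXm.compl]
    have : Xᶜ ∩ Ω = ∅ := by
      ext x
      simpa using fun h hx => h (subset_closure hx)
    rw [this, measure_empty]
  let lam : Measure X := (volume.restrict Ω).comap Subtype.val
  let ν₁ : Measure X := μ₁.comap Subtype.val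
  let ν₂ : Measure X := μ₂.comap Subtype.val
  have : IsFiniteMeasure lam := hfinc _ hfin
  have : IsFiniteMeasure ν₁ := hfinc _ inferInstance
  have : IsFiniteMeasure ν₂ := hfinc _ inferInstance
  have mlam : lam.map Subtype.val = volume.restrict Ω := hmapc _ hΩX
  have mν₁ : ν₁.map Subtype.val = μ₁ := hmapc _ hμ₁
  have mν₂ : ν₂.map Subtype.val = μ₂ := hmapc _ hμ₂
  have huniv : ∀ m : Measure X, m.map Subtype.val Set.univ = m Set.univ := fun m => by
    rw [Measure.map_apply measurable_subtype_coe MeasurableSet.univ, Set.preimage_univ]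
  -- The volume `2` of `Ω` matches the total mass `1 + 1` of the targets.
  have hmass : lam.real Set.univ = (sumMeasure ν₁ ν₂).real Set.univ := by
    rw [measureReal_def, measureReal_def]
    congr 1
    rw [sumMeasure, Measure.add_apply, Measure.map_apply (by fun_prop) MeasurableSet.univ,
      Measure.map_apply (by fun_prop) MeasurableSet.univ, Set.preimage_univ, Set.preimage_univ,
      ← huniv, ← huniv ν₁, ← huniv ν₂, mlam, mν₁, mν₂, Measure.restrict_apply_univ, hvol,
      measure_univ (μ := μ₁), measure_univ (μ := μ₂)]
    norm_num
  let F : Bool → Space d × Space d → ℝ := fun b p =>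
    bif b then A₂ p.1 + κ₂ * cost p.1 p.2 else A₁ p.1 + κ₁ * cost p.1 p.2
  have hF : ∀ b, Continuous (F b) := by
    rintro (_ | _)
    · exact (hA₁.continuous.comp continuous_fst).add (continuous_const.mul continuous_cost)
    · exact (hA₂.continuous.comp continuous_fst).add (continuous_const.mul continuous_cost)
  let C : C(X × (X × Bool), ℝ) :=
    { toFun := fun z => F z.2.2 ((z.1 : Space d), (z.2.1 : Space d))
      continuous_toFun := by
        have h : Continuous fun q : (Space d × Space d) × Bool => F q.2 q.1 :=
          continuous_prod_of_discrete_right.2 hF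
        have h' : Continuous fun z : X × (X × Bool) =>
            (((z.1 : Space d), (z.2.1 : Space d)), z.2.2) := by fun_prop
        exact h.comp h' }
  obtain ⟨π, hπ, hπ1, hπ2, hπC⟩ := exists_plan_integral_le lam (sumMeasure ν₁ ν₂) hmass C
  -- The sum of the Lipschitz constants of the two labelled costs serves for either label.
  let K : NNReal := L₁ + κ₁.toNNReal * (Metric.diam X).toNNReal
    + (L₂ + κ₂.toNNReal * (Metric.diam X).toNNReal)
  have hK : (K : ℝ) = L₁ + κ₁ * Metric.diam X + (L₂ + κ₂ * Metric.diam X) := by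
    simp only [K]
    push_cast
    rw [Real.coe_toNNReal _ hκ₁.le, Real.coe_toNNReal _ hκ₂.le,
      Real.coe_toNNReal _ Metric.diam_nonneg]
  have hlip : ∀ {A : Space d → ℝ} {L : NNReal} {κ : ℝ}, LipschitzWith L A → 0 < κ →
      ∀ x x' y : X, A x + κ * cost (x : Space d) y ≤
        A x' + κ * cost (x' : Space d) y + (L + κ * Metric.diam X) * dist x x' := by
    intro A L κ hA hκ x x' y
    have h1 := hA.le_add_mul x x'
    have h2 := mul_le_mul_of_nonneg_left (cost_le_cost_add hXb x.2 x'.2 y.2) hκ.le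
    have h3 : dist x x' = dist (x : Space d) x' := rfl
    rw [h3]
    linarith
  obtain ⟨u, v, hu, huv, hopt⟩ := exists_optimal_potentials lam (sumMeasure ν₁ ν₂) hmass C K (by
    rintro x x' ⟨y, b⟩
    have hd : 0 ≤ dist x x' := dist_nonneg
    have hD : 0 ≤ Metric.diam X := Metric.diam_nonneg
    have n₁ : 0 ≤ (L₁ + κ₁ * Metric.diam X) * dist x x' := by positivity
    have n₂ : 0 ≤ (L₂ + κ₂ * Metric.diam X) * dist x x' := by positivity
    rw [hK, _root_.add_mul (L₁ + κ₁ * Metric.diam X : ℝ)]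
    cases b
    · have := hlip hA₁ hκ₁ x x' y
      change A₁ x + κ₁ * cost (x : Space d) y ≤ A₁ x' + κ₁ * cost (x' : Space d) y + _
      linarith
    · have := hlip hA₂ hκ₂ x x' y
      change A₂ x + κ₂ * cost (x : Space d) y ≤ A₂ x' + κ₂ * cost (x' : Space d) y + _
      linarith)
  -- Optimality of `(u, v)` bounds every dual value by its own, so the plan costs at most that
  -- value: no duality gap.
  have hdual := hπC _ hopt
  let ext : (X → ℝ) → Space d → ℝ := fun f => Function.extend Subtype.val f 0
  have ext_apply : ∀ (f : X → ℝ) (x : X), ext f x = f x := fun f x =>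
    Subtype.val_injective.extend_apply f 0 x
  have ext_cont : ∀ f : X → ℝ, Continuous f → ContinuousOn (ext f) X := fun f hf => by
    rw [continuousOn_iff_continuous_domRestrict]
    convert hf using 1
    exact funext fun x => ext_apply f x
  have ext_int : ∀ (f : X → ℝ) (m : Measure (Space d)),
      ∫ x in X, ext f x ∂m = ∫ x, f x ∂(m.comap (Subtype.val : X → Space d)) := fun f m => by
    rw [← integral_subtype_comap hXm]
    simp_rw [ext_apply]
  refine ⟨ext u, ext fun y => v (y, false), ext fun y => v (y, true), ⟨K, ?_⟩,
    ext_cont _ (by fun_prop), ext_cont _ (by fun_prop), ?_, ?_, ?_⟩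
  · refine LipschitzOnWith.of_dist_le_mul fun x hx y hy => ?_
    have := hu.dist_le_mul ⟨x, hx⟩ ⟨y, hy⟩
    rwa [← ext_apply u, ← ext_apply u] at this
  · intro x hx y hy
    have h1 := ext_apply u ⟨x, hx⟩
    have h2 := ext_apply (fun y => v (y, false)) ⟨y, hy⟩
    simp only at h1 h2
    rw [h1, h2]
    exact huv ⟨x, hx⟩ (⟨y, hy⟩, false)
  · intro x hx y hy
    have h1 := ext_apply u ⟨x, hx⟩
    have h2 := ext_apply (fun y => v (y, true)) ⟨y, hy⟩
    simp only at h1 h2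
    rw [h1, h2]
    exact huv ⟨x, hx⟩ (⟨y, hy⟩, true)
  have hs₁ : (planComponent π false).map Prod.snd = μ₁ :=
    (planComponent_map_snd hπ2 false).trans mν₁
  have hs₂ : (planComponent π true).map Prod.snd = μ₂ :=
    (planComponent_map_snd hπ2 true).trans mν₂
  set m₁ := (planComponent π false).map Prod.fst with hm₁
  set m₂ := (planComponent π true).map Prod.fst with hm₂
  have hm : m₁ + m₂ = volume.restrict Ω := by
    rw [hm₁, hm₂, planComponent_add_map_fst, hπ1, mlam]
  have hprob : ∀ (q : Measure (Space d × Space d)) (μ : Measure (Space d)),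
      IsProbabilityMeasure μ → q.map Prod.snd = μ → IsProbabilityMeasure (q.map Prod.fst) := by
    intro q μ _ hq
    refine ⟨?_⟩
    rw [Measure.map_apply measurable_fst MeasurableSet.univ, Set.preimage_univ,
      ← Set.preimage_univ (f := Prod.snd), ← Measure.map_apply measurable_snd MeasurableSet.univ,
      hq, measure_univ]
  have : IsProbabilityMeasure m₁ := hprob _ μ₁ inferInstance hs₁
  have : IsProbabilityMeasure m₂ := hprob _ μ₂ inferInstance hs₂
  obtain ⟨η₁, η₂, hη, e₁, e₂⟩ := exists_admissible_of_measure_add (by simp [hvol]) m₁ m₂ hm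
  refine ⟨η₁, η₂, hη, ?_⟩
  -- Each component of the plan is only a competitor in its own transport problem, so replacing its
  -- cost by `W2sq` decreases the total.
  have hcomp : ∀ {A : Space d → ℝ} {L : NNReal} {κ : ℝ} {η : Space d → ℝ} {μ : Measure (Space d)}
      {q : Measure (Space d × Space d)}, IsProbabilityMeasure μ → μ Xᶜ = 0 → LipschitzWith L A →
      0 < κ → IsProbDensity Ω η → q ∈ transportPlans (densityMeasure Ω η) μ →
      (∫ x in Ω, A x * η x) + κ * (W2sq (densityMeasure Ω η) μ / 2) ≤
        ∫ p, (A p.1 + κ * cost p.1 p.2) ∂q := by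
    intro A L κ η μ q _ hμ hA hκ hη hq
    have := hη.isProbabilityMeasure
    have hηX := densityMeasure_compl_closure Ω η
    have hW := W2sq_le_integral hXb hηX hμ hq
    have hi := integrable_sq_of_mem_transportPlans hXb hηX hμ hq
    have hi' : Integrable (fun p : Space d × Space d => κ * cost p.1 p.2) q :=
      (hi.div_const 2).const_mul κ
    have hAi : Integrable A (densityMeasure Ω η) := by
      have := hA.continuous.continuousOn.integrableOn_compact (μ := densityMeasure Ω η) hXc
      rwa [IntegrableOn, restrict_eq_of_measure_compl hηX] at this
    have hA1 : Integrable (fun p : Space d × Space d => A p.1) q := by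
      rw [← hq.1] at hAi
      exact hAi.comp_measurable measurable_fst
    have hA2 : ∫ p, A p.1 ∂q = ∫ x in Ω, A x * η x := by
      rw [← hη.integral_densityMeasure A, ← hq.1, integral_map measurable_fst.aemeasurable
        hA.continuous.aestronglyMeasurable]
    rw [integral_add hA1 hi', hA2, integral_const_mul]
    simp only [cost]
    rw [integral_div]
    gcongr
  have c₁ := hcomp inferInstance hμ₁ hA₁ hκ₁ hη.left (q := planComponent π false)
    ⟨e₁.symm, hs₁⟩
  have c₂ := hcomp inferInstance hμ₂ hA₂ hκ₂ hη.right (q := planComponent π true)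
    ⟨e₂.symm, hs₂⟩
  have hsplit := integral_planComponent_add (C.integrable_of_compactSpace π) hF fun z => rfl
  have hv : ∫ y, v y ∂(sumMeasure ν₁ ν₂) = ∫ y, v (y, false) ∂ν₁ + ∫ y, v (y, true) ∂ν₂ := by
    rw [sumMeasure, integral_add_measure (v.integrable_of_compactSpace _)
      (v.integrable_of_compactSpace _), integral_map (by fun_prop)
      v.continuous.aestronglyMeasurable, integral_map (by fun_prop)
      v.continuous.aestronglyMeasurable]
  have hu' : ∫ x in Ω, ext u x = ∫ x, u x ∂lam := by
    rw [← ext_int, restrict_eq_of_measure_compl hΩX]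
  rw [ext_int _ μ₁, ext_int _ μ₂, hu']
  rw [hv, hsplit] at hdual
  simp only [F, cond_false, cond_true] at hdual
  linarith

end Muskat

namespace Muskat

variable {d : ℕ}

/-! ### Optimality conditions -/

/-- Given a dual pair that is optimal for one component, there is a Kantorovich potential that
satisfies the complementary slackness conditions. -/
theorem exists_potential_of_optimal {Ω : Set (Space d)} (hb : Bornology.IsBounded Ω)
    (hne : Ω.Nonempty) {ρ : Space d → ℝ} (hρ : IsProbDensity Ω ρ) {μ : Measure (Space d)}
    [IsProbabilityMeasure μ] (hμ : μ (closure Ω)ᶜ = 0) {A u v : Space d → ℝ} (hA : Continuous A)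
    (hu : ContinuousOn u (closure Ω)) (hv : ContinuousOn v (closure Ω)) {κ : ℝ} (hκ : 0 < κ)
    (huv : ∀ x ∈ closure Ω, ∀ y ∈ closure Ω, u x + v y ≤ A x + κ * cost x y)
    (hopt : (∫ x in Ω, A x * ρ x) + κ * (W2sq (densityMeasure Ω ρ) μ / 2) ≤
      (∫ x in Ω, u x * ρ x) + ∫ y in closure Ω, v y ∂μ) :
    ∃ φ : Space d → ℝ, IsKantorovichPotential (closure Ω) (densityMeasure Ω ρ) μ φ ∧
      (∃ L, LipschitzOnWith L φ (closure Ω)) ∧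
      (∀ x ∈ closure Ω, 0 ≤ A x + κ * φ x - u x) ∧
      (∫ x in Ω, (A x + κ * φ x - u x) * ρ x = 0) ∧
      ∀ x ∈ spt Ω ρ, A x + κ * φ x - u x = 0 := by
  set X : Set (Space d) := closure Ω with hX
  have hXc : IsCompact X := hb.isCompact_closure
  have hXne : X.Nonempty := hne.closure
  have := hρ.isProbabilityMeasure
  have hρX : densityMeasure Ω ρ Xᶜ = 0 := densityMeasure_compl_closure Ω ρ
  set f : Space d → ℝ := fun x => (u x - A x) / κ with hf
  set g : Space d → ℝ := fun y => v y / κ with hg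
  have hfc : ContinuousOn f X := (hu.sub hA.continuousOn).div_const κ
  have hgc : ContinuousOn g X := hv.div_const κ
  have hfg : ∀ x ∈ X, ∀ y ∈ X, f x + g y ≤ cost x y := fun x hx y hy => by
    simp only [hf, hg]
    rw [← add_div, div_le_iff₀' hκ]
    linarith [huv x hx y hy]
  have int : ∀ {w : Space d → ℝ}, ContinuousOn w X → IntegrableOn w X (densityMeasure Ω ρ) :=
    fun hw => hw.integrableOn_compact hXc
  have hfint : ∫ x in X, f x ∂densityMeasure Ω ρ =
      ((∫ x in Ω, u x * ρ x) - ∫ x in Ω, A x * ρ x) / κ := by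
    rw [integral_div, integral_sub (int hu) (int hA.continuousOn), hρ.setIntegral_closure,
      hρ.setIntegral_closure]
  have hgint : ∫ y in X, g y ∂μ = (∫ y in X, v y ∂μ) / κ := integral_div _ _
  obtain ⟨hK, hφf⟩ := isKantorovichPotential_of_optimal hXc hfc hXne hgc hfg hρX hμ (by
    rw [hfint, hgint, ← add_div, le_div_iff₀' hκ]
    linarith)
  have hψc : ContinuousOn (cTransform X f) X :=
    (lipschitzOnWith_cTransform hXc hfc hXne).continuousOn
  have hφl := lipschitzOnWith_cTransform hXc hψc hXne
  set φ : Space d → ℝ := cTransform X (cTransform X f) with hφ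
  have hφc : ContinuousOn φ X := hφl.continuousOn
  have hnonneg : ∀ x ∈ X, 0 ≤ A x + κ * φ x - u x := fun x hx => by
    have h1 := le_cTransform_cTransform hXc hfc hXne hx
    simp only [hf] at h1
    rw [div_le_iff₀' hκ] at h1
    linarith
  have hφc' : ContinuousOn (fun x => κ * φ x) X := continuousOn_const.mul hφc
  have hc : ContinuousOn (fun x => A x + κ * φ x - u x) X := (hA.continuousOn.add hφc').sub hu
  -- `φ` and `f = (u - A) / κ` have the same integral against `ρ`, although `f ≤ φ` pointwise.
  have hzero : ∫ x in X, (A x + κ * φ x - u x) ∂densityMeasure Ω ρ = 0 := by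
    rw [integral_sub (by exact (int hA.continuousOn).add (int hφc')) (int hu),
      integral_add (int hA.continuousOn) (int hφc'), integral_const_mul, hφf, hfint,
      hρ.setIntegral_closure, hρ.setIntegral_closure]
    field_simp
    ring
  refine ⟨φ, hK, ⟨_, hφl⟩, hnonneg, ?_, ?_⟩
  · rw [← hρ.setIntegral_closure]
    exact hzero
  -- A nonnegative slack with zero integral vanishes a.e. for the measure; by continuity its zero
  -- set in `X` is closed, hence contains the whole support.
  · have hae := (setIntegral_eq_zero_iff_of_nonneg_ae
      (ae_restrict_of_forall_mem hXc.measurableSet hnonneg) (int hc)).1 hzero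
    rw [restrict_eq_of_measure_compl hρX] at hae
    have hclosed : IsClosed (X ∩ (fun x => A x + κ * φ x - u x) ⁻¹' {0}) :=
      hc.preimage_isClosed_of_isClosed hXc.isClosed isClosed_singleton
    have hsub : spt Ω ρ ⊆ X ∩ (fun x => A x + κ * φ x - u x) ⁻¹' {0} := by
      refine Measure.support_subset_of_isClosed hclosed ?_
      have hXae : ∀ᵐ x ∂densityMeasure Ω ρ, x ∈ X := hρX
      filter_upwards [hae, hXae] with x h1 h2
      exact ⟨h2, h1⟩
    exact fun x hx => (hsub hx).2

theorem spt_subset_closure (Ω : Set (Space d)) (ρ : Space d → ℝ) : spt Ω ρ ⊆ closure Ω :=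
  Measure.support_subset_of_isClosed isClosed_closure (densityMeasure_compl_closure Ω ρ)

theorem ae_differentiableAt_of_lipschitzOn {Ω : Set (Space d)} (hΩ : IsOpen Ω)
    {f : Space d → ℝ} {L : NNReal} (hf : LipschitzOnWith L f Ω) :
    ∀ᵐ x ∂volume.restrict Ω, DifferentiableAt ℝ f x := by
  rw [ae_restrict_iff' hΩ.measurableSet]
  filter_upwards [hf.ae_differentiableWithinAt_of_mem (μ := volume)] with x hx hxΩ
  exact (hx hxΩ).differentiableAt (hΩ.mem_nhds hxΩ)

/-- The first order condition at a minimum of `k + Φ + κ φ + p`. -/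
theorem gradient_eq_of_isLocalMin {k Φ φ p : Space d → ℝ} {x g : Space d} {κ : ℝ}
    (hk : HasGradientAt k g x) (hΦ : DifferentiableAt ℝ Φ x) (hφ : DifferentiableAt ℝ φ x)
    (hp : DifferentiableAt ℝ p x) (hmin : IsLocalMin (fun y => k y + Φ y + κ * φ y + p y) x) :
    gradient p x = -g - gradient Φ x - κ • gradient φ x := by
  have h := ((hk.hasFDerivAt.add hΦ.hasFDerivAt).add (hφ.hasFDerivAt.const_mul κ)).add
    hp.hasFDerivAt
  have h0 := hmin.hasFDerivAt_eq_zero h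
  have h1 : fderiv ℝ p x = -(InnerProductSpace.toDual ℝ (Space d) g) - fderiv ℝ Φ x
      - κ • fderiv ℝ φ x := by
    rw [← sub_eq_zero, ← h0]
    abel
  rw [gradient, h1, map_sub, map_sub, map_neg, LinearIsometryEquiv.symm_apply_apply, gradient,
    gradient]
  simp

/-- The constraint makes a common weight contribute the same amount to every admissible pair. This
allows the pressure to be added or dropped. -/
theorem setIntegral_mul_add_mul_eq {Ω : Set (Space d)} {u : Space d → ℝ}
    (hu : ∀ {ρ : Space d → ℝ}, IntegrableOn ρ Ω → IntegrableOn (fun x => u x * ρ x) Ω)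
    {η₁ η₂ : Space d → ℝ} (hη : Admissible Ω η₁ η₂) :
    (∫ x in Ω, u x * η₁ x) + ∫ x in Ω, u x * η₂ x = ∫ x in Ω, u x := by
  rw [← integral_add (hu hη.left.integrableOn) (hu hη.right.integrableOn)]
  refine integral_congr_ae ?_
  filter_upwards [hη.sum_eq_one] with x hx
  rw [← mul_add, hx, mul_one]

/-- The slack `h ≥ 0` that vanishes against `ρ` makes `∫ h (η - ρ)` nonnegative. -/
theorem setIntegral_mul_sub_nonneg {Ω : Set (Space d)} (hΩ : IsOpen Ω) {h ρ η : Space d → ℝ}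
    (hi : ∀ {ρ : Space d → ℝ}, IntegrableOn ρ Ω → IntegrableOn (fun x => h x * ρ x) Ω)
    (hnonneg : ∀ x ∈ Ω, 0 ≤ h x) (hρ : IsProbDensity Ω ρ) (hη : IsProbDensity Ω η)
    (hzero : ∫ x in Ω, h x * ρ x = 0) : 0 ≤ ∫ x in Ω, h x * (η x - ρ x) := by
  simp_rw [mul_sub]
  rw [integral_sub (hi hη.integrableOn) (hi hρ.integrableOn), hzero, sub_zero]
  refine integral_nonneg_of_ae ?_
  filter_upwards [hη.nonneg, ae_restrict_mem hΩ.measurableSet] with x h1 h2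
  exact mul_nonneg (hnonneg x h2) h1

end Muskat

/-! ### Assembly of the optimality conditions -/

theorem mainTheorem6 {d : ℕ} (Ω : Set (Muskat.Space d))
    (hΩ_open : IsOpen Ω) (hΩ_convex : Convex ℝ Ω) (hΩ_bdd : Bornology.IsBounded Ω)
    (hΩ_vol : volume Ω = 2)
    (σ ε τ b₁ b₂ : ℝ) (hσ : 0 < σ) (hε : 0 < ε) (hτ : 0 < τ) (hb₁ : 0 < b₁) (hb₂ : 0 < b₂)
    (Φ₁ Φ₂ : Muskat.Space d → ℝ)
    (hΦ₁ : ∃ L : NNReal, LipschitzOnWith L Φ₁ Ω) (hΦ₂ : ∃ L : NNReal, LipschitzOnWith L Φ₂ Ω)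
    (μ₁ μ₂ : Measure (Muskat.Space d)) [IsProbabilityMeasure μ₁] [IsProbabilityMeasure μ₂]
    (hμ₁ : μ₁ (closure Ω)ᶜ = 0) (hμ₂ : μ₂ (closure Ω)ᶜ = 0)
    (ρ₁ ρ₂ : Muskat.Space d → ℝ)
    (hmin : Muskat.IsStepMinimizer σ ε τ b₁ b₂ Φ₁ Φ₂ Ω μ₁ μ₂ ρ₁ ρ₂) :
    ∃ φ₁ φ₂ : Muskat.Space d → ℝ,
      Muskat.IsKantorovichPotential (closure Ω) (Muskat.densityMeasure Ω ρ₁) μ₁ φ₁ ∧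
      Muskat.IsKantorovichPotential (closure Ω) (Muskat.densityMeasure Ω ρ₂) μ₂ φ₂ ∧
      (∀ η₁ η₂ : Muskat.Space d → ℝ, Muskat.Admissible Ω η₁ η₂ →
        0 ≤ (∫ x in Ω, (Muskat.convK σ ε Ω ρ₂ x + Φ₁ x + b₁ * φ₁ x / τ) * (η₁ x - ρ₁ x))
          + ∫ x in Ω, (Muskat.convK σ ε Ω ρ₁ x + Φ₂ x + b₂ * φ₂ x / τ) * (η₂ x - ρ₂ x)) ∧
      ∃ p : Muskat.Space d → ℝ,
        (∃ L : NNReal, LipschitzOnWith L p (Muskat.spt Ω ρ₁)) ∧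
        (∃ L : NNReal, LipschitzOnWith L p (Muskat.spt Ω ρ₂)) ∧
        (∀ η₁ η₂ : Muskat.Space d → ℝ, Muskat.Admissible Ω η₁ η₂ →
          0 ≤ (∫ x in Ω,
                (Muskat.convK σ ε Ω ρ₂ x + Φ₁ x + b₁ * φ₁ x / τ + p x) * (η₁ x - ρ₁ x))
            + ∫ x in Ω,
                (Muskat.convK σ ε Ω ρ₁ x + Φ₂ x + b₂ * φ₂ x / τ + p x) * (η₂ x - ρ₂ x)) ∧
        (∀ᵐ x ∂volume.restrict Ω, x ∈ Muskat.spt Ω ρ₁ →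
          DifferentiableAt ℝ p x ∧ DifferentiableAt ℝ Φ₁ x ∧ DifferentiableAt ℝ φ₁ x ∧
          gradient p x =
            -Muskat.convGradK σ ε Ω ρ₂ x - gradient Φ₁ x - (b₁ / τ) • gradient φ₁ x) ∧
        (∀ᵐ x ∂volume.restrict Ω, x ∈ Muskat.spt Ω ρ₂ →
          DifferentiableAt ℝ p x ∧ DifferentiableAt ℝ Φ₂ x ∧ DifferentiableAt ℝ φ₂ x ∧
          gradient p x =
            -Muskat.convGradK σ ε Ω ρ₁ x - gradient Φ₂ x - (b₂ / τ) • gradient φ₂ x) := by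
  obtain ⟨L₁, hΦ₁⟩ := hΦ₁
  obtain ⟨L₂, hΦ₂⟩ := hΦ₂
  -- The dual problem lives on `closure Ω`, where `Φ_i` is not controlled at the boundary; globally
  -- Lipschitz extensions replace it and agree with it on `Ω`.
  obtain ⟨Ψ₁, hΨ₁, hΦΨ₁⟩ := hΦ₁.extend_real
  obtain ⟨Ψ₂, hΨ₂, hΦΨ₂⟩ := hΦ₂.extend_real
  have hρ := hmin.1
  have hne : Ω.Nonempty := by
    rw [Set.nonempty_iff_ne_empty]
    rintro rfl
    simp at hΩ_vol
  have iρ₁ := hρ.left.integrableOn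
  have iρ₂ := hρ.right.integrableOn
  have pρ₁ := hρ.left.isProbabilityMeasure
  have pρ₂ := hρ.right.isProbabilityMeasure
  have hXc : IsCompact (closure Ω) := hΩ_bdd.isCompact_closure
  obtain ⟨M₁, hM₁⟩ := Muskat.exists_lipschitzWith_convK σ hε iρ₂
  obtain ⟨M₂, hM₂⟩ := Muskat.exists_lipschitzWith_convK σ hε iρ₁
  set A₁ : Muskat.Space d → ℝ := fun x => Muskat.convK σ ε Ω ρ₂ x + Ψ₁ x with hA₁
  set A₂ : Muskat.Space d → ℝ := fun x => Muskat.convK σ ε Ω ρ₁ x + Ψ₂ x with hA₂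
  have lA₁ : LipschitzWith (M₁ + L₁) A₁ := hM₁.add hΨ₁
  have lA₂ : LipschitzWith (M₂ + L₂) A₂ := hM₂.add hΨ₂
  have hκ₁ : 0 < b₁ / τ := div_pos hb₁ hτ
  have hκ₂ : 0 < b₂ / τ := div_pos hb₂ hτ
  obtain ⟨u, v₁, v₂, ⟨L, hu⟩, hv₁, hv₂, huv₁, huv₂, η₁, η₂, hη, hdual⟩ :=
    Muskat.exists_dual_potentials_pair hΩ_open hΩ_bdd hΩ_vol μ₁ μ₂ hμ₁ hμ₂ lA₁ lA₂ hκ₁ hκ₂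
  have hlin := hmin.linearized_le hΩ_open hΩ_bdd hε hτ hb₁ hb₂ hΦ₁ hΦ₂ hμ₁ hμ₂ hη
  have congrA₁ : ∀ ρ : Muskat.Space d → ℝ,
      ∫ x in Ω, (Muskat.convK σ ε Ω ρ₂ x + Φ₁ x) * ρ x = ∫ x in Ω, A₁ x * ρ x := fun ρ =>
    setIntegral_congr_fun hΩ_open.measurableSet fun x hx => by simp only [hA₁, hΦΨ₁ hx]
  have congrA₂ : ∀ ρ : Muskat.Space d → ℝ,
      ∫ x in Ω, (Muskat.convK σ ε Ω ρ₁ x + Φ₂ x) * ρ x = ∫ x in Ω, A₂ x * ρ x := fun ρ =>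
    setIntegral_congr_fun hΩ_open.measurableSet fun x hx => by simp only [hA₂, hΦΨ₂ hx]
  rw [congrA₁, congrA₁, congrA₂, congrA₂] at hlin
  have mul_int : ∀ {f : Muskat.Space d → ℝ} {K : NNReal}, LipschitzOnWith K f Ω →
      ∀ {ρ : Muskat.Space d → ℝ}, IntegrableOn ρ Ω → IntegrableOn (fun x => f x * ρ x) Ω :=
    fun hf _ hρ => Muskat.integrableOn_mul_of_lipschitzOn hΩ_open hΩ_bdd hf hρ
  have uΩ : LipschitzOnWith L u Ω := hu.mono subset_closure
  have usum := Muskat.setIntegral_mul_add_mul_eq (mul_int uΩ) hρ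
  have weak : ∀ {A v ρ : Muskat.Space d → ℝ} {κ : ℝ} {K : NNReal} {μ : Measure (Muskat.Space d)},
      IsProbabilityMeasure μ → μ (closure Ω)ᶜ = 0 → LipschitzWith K A → 0 < κ →
      ContinuousOn v (closure Ω) → Muskat.IsProbDensity Ω ρ →
      (∀ x ∈ closure Ω, ∀ y ∈ closure Ω, u x + v y ≤ A x + κ * Muskat.cost x y) →
      (∫ x in Ω, u x * ρ x) + (∫ y in closure Ω, v y ∂μ) ≤
        (∫ x in Ω, A x * ρ x) + κ * (Muskat.W2sq (Muskat.densityMeasure Ω ρ) μ / 2) := by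
    intro A v ρ κ K μ _ hμ hA hκ hv hρ huv
    have := hρ.isProbabilityMeasure
    have h := Muskat.weak_duality (f := fun x => (u x - A x) / κ) (g := fun y => v y / κ) hXc
      (Muskat.densityMeasure_compl_closure Ω ρ) hμ
      ((hu.continuousOn.sub hA.continuous.continuousOn).div_const κ) (hv.div_const κ)
      (fun x hx y hy => by
        rw [← add_div, div_le_iff₀' hκ]
        linarith [huv x hx y hy])
    rw [integral_div, integral_div, ← add_div, div_le_iff₀' hκ,
      hρ.setIntegral_closure] at h
    simp_rw [sub_mul] at h
    rw [integral_sub (mul_int uΩ hρ.integrableOn)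
      (mul_int hA.lipschitzOnWith hρ.integrableOn)] at h
    linarith
  have w₁ := weak inferInstance hμ₁ lA₁ hκ₁ hv₁ hρ.left huv₁
  have w₂ := weak inferInstance hμ₂ lA₂ hκ₂ hv₂ hρ.right huv₂
  -- By `hlin` and `hdual` the total primal value at `ρ` is at most the dual value, which by `usum`
  -- is the sum of the left sides of `w₁` and `w₂`. Both inequalities are therefore equalities, for
  -- each component separately.
  obtain ⟨φ₁, hK₁, ⟨N₁, lφ₁⟩, pos₁, zero₁, spt₁⟩ := Muskat.exists_potential_of_optimal hΩ_bdd hne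
    hρ.left hμ₁ lA₁.continuous hu.continuousOn hv₁ hκ₁ huv₁ (by linarith)
  obtain ⟨φ₂, hK₂, ⟨N₂, lφ₂⟩, pos₂, zero₂, spt₂⟩ := Muskat.exists_potential_of_optimal hΩ_bdd hne
    hρ.right hμ₂ lA₂.continuous hu.continuousOn hv₂ hκ₂ huv₂ (by linarith)
  have slack_int : ∀ {A φ : Muskat.Space d → ℝ} {K N : NNReal} {κ : ℝ}, LipschitzWith K A →
      LipschitzOnWith N φ (closure Ω) → ∀ {ρ : Muskat.Space d → ℝ}, IntegrableOn ρ Ω →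
      IntegrableOn (fun x => (A x + κ * φ x - u x) * ρ x) Ω := by
    intro A φ K N κ hA hφ ρ hρ
    have h := ((mul_int hA.lipschitzOnWith hρ).add
      ((mul_int (hφ.mono subset_closure) hρ).const_mul κ)).sub (mul_int uΩ hρ)
    refine h.congr (Filter.Eventually.of_forall fun x => ?_)
    simp only [Pi.add_apply, Pi.sub_apply]
    ring
  have slack₁ : ∀ {ζ₁ ζ₂ : Muskat.Space d → ℝ}, Muskat.Admissible Ω ζ₁ ζ₂ →
      0 ≤ ∫ x in Ω, (A₁ x + b₁ / τ * φ₁ x - u x) * (ζ₁ x - ρ₁ x) := fun hζ =>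
    Muskat.setIntegral_mul_sub_nonneg hΩ_open (slack_int lA₁ lφ₁)
      (fun x hx => pos₁ x (subset_closure hx)) hρ.left hζ.left zero₁
  have slack₂ : ∀ {ζ₁ ζ₂ : Muskat.Space d → ℝ}, Muskat.Admissible Ω ζ₁ ζ₂ →
      0 ≤ ∫ x in Ω, (A₂ x + b₂ / τ * φ₂ x - u x) * (ζ₂ x - ρ₂ x) := fun hζ =>
    Muskat.setIntegral_mul_sub_nonneg hΩ_open (slack_int lA₂ lφ₂)
      (fun x hx => pos₂ x (subset_closure hx)) hρ.right hζ.right zero₂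
  refine ⟨φ₁, φ₂, hK₁, hK₂, fun ζ₁ ζ₂ hζ => ?_, fun x => -u x,
    ⟨L, (hu.mono (Muskat.spt_subset_closure Ω ρ₁)).neg⟩,
    ⟨L, (hu.mono (Muskat.spt_subset_closure Ω ρ₂)).neg⟩, fun ζ₁ ζ₂ hζ => ?_, ?_, ?_⟩
  · have iζ₁ : IntegrableOn (fun x => ζ₁ x - ρ₁ x) Ω := hζ.left.integrableOn.sub iρ₁
    have iζ₂ : IntegrableOn (fun x => ζ₂ x - ρ₂ x) Ω := hζ.right.integrableOn.sub iρ₂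
    have e₁ : ∫ x in Ω, (Muskat.convK σ ε Ω ρ₂ x + Φ₁ x + b₁ * φ₁ x / τ) * (ζ₁ x - ρ₁ x) =
        (∫ x in Ω, (A₁ x + b₁ / τ * φ₁ x - u x) * (ζ₁ x - ρ₁ x))
          + ∫ x in Ω, u x * (ζ₁ x - ρ₁ x) := by
      rw [← integral_add (slack_int lA₁ lφ₁ iζ₁) (mul_int uΩ iζ₁)]
      refine setIntegral_congr_fun hΩ_open.measurableSet fun x hx => ?_
      simp only [hA₁, hΦΨ₁ hx]
      ring
    have e₂ : ∫ x in Ω, (Muskat.convK σ ε Ω ρ₁ x + Φ₂ x + b₂ * φ₂ x / τ) * (ζ₂ x - ρ₂ x) =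
        (∫ x in Ω, (A₂ x + b₂ / τ * φ₂ x - u x) * (ζ₂ x - ρ₂ x))
          + ∫ x in Ω, u x * (ζ₂ x - ρ₂ x) := by
      rw [← integral_add (slack_int lA₂ lφ₂ iζ₂) (mul_int uΩ iζ₂)]
      refine setIntegral_congr_fun hΩ_open.measurableSet fun x hx => ?_
      simp only [hA₂, hΦΨ₂ hx]
      ring
    -- The two leftover `u`-integrals cancel, since both pairs sum to one.
    have usum' := Muskat.setIntegral_mul_add_mul_eq (mul_int uΩ) hζ
    have d₁ : ∫ x in Ω, u x * (ζ₁ x - ρ₁ x) =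
        (∫ x in Ω, u x * ζ₁ x) - ∫ x in Ω, u x * ρ₁ x := by
      simp_rw [mul_sub]
      exact integral_sub (mul_int uΩ hζ.left.integrableOn) (mul_int uΩ iρ₁)
    have d₂ : ∫ x in Ω, u x * (ζ₂ x - ρ₂ x) =
        (∫ x in Ω, u x * ζ₂ x) - ∫ x in Ω, u x * ρ₂ x := by
      simp_rw [mul_sub]
      exact integral_sub (mul_int uΩ hζ.right.integrableOn) (mul_int uΩ iρ₂)
    rw [e₁, e₂, d₁, d₂]
    linarith [slack₁ hζ, slack₂ hζ]
  · refine add_nonneg ((slack₁ hζ).trans_eq ?_) ((slack₂ hζ).trans_eq ?_)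
    · refine setIntegral_congr_fun hΩ_open.measurableSet fun x hx => ?_
      simp only [hA₁, hΦΨ₁ hx]
      ring
    · refine setIntegral_congr_fun hΩ_open.measurableSet fun x hx => ?_
      simp only [hA₂, hΦΨ₂ hx]
      ring
  · filter_upwards [ae_restrict_mem hΩ_open.measurableSet,
      Muskat.ae_differentiableAt_of_lipschitzOn hΩ_open uΩ,
      Muskat.ae_differentiableAt_of_lipschitzOn hΩ_open hΦ₁,
      Muskat.ae_differentiableAt_of_lipschitzOn hΩ_open (lφ₁.mono subset_closure)]
      with x hx h1 h2 h3 hspt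
    refine ⟨h1.neg, h2, h3, Muskat.gradient_eq_of_isLocalMin
      (Muskat.hasGradientAt_convK σ hε iρ₂ x) h2 h3 h1.neg ?_⟩
    -- The slack is zero at the support point `x` and nonnegative throughout `Ω`, so `x` is a local
    -- minimum.
    filter_upwards [hΩ_open.mem_nhds hx] with y hy
    have hx0 := spt₁ x hspt
    have hy0 := pos₁ y (subset_closure hy)
    simp only [hA₁, ← hΦΨ₁ hx] at hx0
    simp only [hA₁, ← hΦΨ₁ hy] at hy0
    linarith
  · filter_upwards [ae_restrict_mem hΩ_open.measurableSet,
      Muskat.ae_differentiableAt_of_lipschitzOn hΩ_open uΩ,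
      Muskat.ae_differentiableAt_of_lipschitzOn hΩ_open hΦ₂,
      Muskat.ae_differentiableAt_of_lipschitzOn hΩ_open (lφ₂.mono subset_closure)]
      with x hx h1 h2 h3 hspt
    refine ⟨h1.neg, h2, h3, Muskat.gradient_eq_of_isLocalMin
      (Muskat.hasGradientAt_convK σ hε iρ₁ x) h2 h3 h1.neg ?_⟩
    filter_upwards [hΩ_open.mem_nhds hx] with y hy
    have hx0 := spt₂ x hspt
    have hy0 := pos₂ y (subset_closure hy)
    simp only [hA₂, ← hΦΨ₂ hx] at hx0
    simp only [hA₂, ← hΦΨ₂ hy] at hy0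
    linarith
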